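/- **Setting.** Nodes $a_1,a_2,\dots$ test $H_0$ against $H_1$, with prior probabilities $\pi_0,\pi_1>0$, $\pi_0+\pi_1=1$; $\mathbb P_j$ denotes probability under $H_j$. Node $a_k$ has a private signal $X_k$; under $H_j$ the signals are i.i.d. with law $\mathbb P_j^X$, where $\mathbb P_0^X$ and $\mathbb P_1^X$ are mutually absolutely continuous, $L_X=d\mathbb P_1^X/d\mathbb P_0^X$. Assume that the private belief $\bar b=\pi_1L_X/(\pi_0+\pi_1L_X)$ has linear tails: $\mathbb P_0^X(\bar b\le r)=\Theta(r)$ and $\mathbb P_1^X(\bar b\ge 1-r)=\Theta(r)$ as $r\downarrow 0$. The decision broadcast by $a_k$ passes through a memoryless binary erasure channel: it is erased (for all successors) with probability $q_k$, independently of the decision, of the other erasures and of the signals, under either hypothesis. The erasure probabilities are bounded away from $1$: $q_k\le 1-\epsilon$ for all $k$, for some $\epsilon>0$. Node $a_k$ observes the broadcasts of its $m_k<k$ immediate predecessors. **Scheme (backward search with the equilibrium strategy).** Let $n_k$ be the largest integer $n$ with $k-n^2\ge 1$ such that each of $a_{k-n^2},\dots,a_k$ has memory size at least $n$. Put $k_0=k$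 and let $a_{k_{i+1}}$ be the most recent node among the $n_k$ immediate predecessors of $a_{k_i}$ whose broadcast is not erased; $\mathcal E_k$ is the event that $k_1,\dots,k_{n_k}$ all exist, so that $a_{k_{n_k}},\dots,a_{k_1},a_k$ form a tandem network of length $n_k$. On $\mathcal E_k$ the nodes of this tandem network use the equilibrium strategy of a tandem network, i.e. each node applies the maximum a posteriori test to what it has: the first node decides $1$ iff $L_X>\pi_0/\pi_1$ at its signal; a node with $i+1$ tandem predecessors that receives the decision $b$ of its immediate tandem predecessor decides $1$ iff $L_X\cdot p_1^{i}(b)/p_0^{i}(b)>\pi_0/\pi_1$, where $p_j^{i}$ is the law under $H_j$ of the decision of a tandem node with $i$ predecessors. The decision $d_k$ is the resulting decision of $a_k$ on $\mathcal E_k$, and arbitrary off $\mathcal E_k$. **Corollary 3.** Suppose that $m_k=\Theta(k^\sigma)$ where $\sigma\le 1$. Then the error probability $\mathbb P(d_k\ne\theta)=\pi_0\mathbb P_0(d_k=1)+\pi_1\mathbb P_1(d_k=0)$ satisfies, as $k\to\infty$, $$\mathbb P(d_k\neq\theta)=\begin{cases}\Theta(1/\sqrt k)&\text{if }\sigma\ge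 1/2,\\ \Theta(1/k^{\sigma})&\text{if }\sigma<1/2.\end{cases}$$ -/

import Mathlib

open MeasureTheory ProbabilityTheory Filter Asymptotics Topology
open scoped ENNReal

/-! Hypotheses and decisions are Booleans: `false` stands for `H₀` / decision `0`, `true` for
`H₁` / decision `1`.  Nodes are `a₁, a₂, …`; index `0` is never used. -/

namespace ErasureNetwork

noncomputable section

variable {S : Type*} [MeasurableSpace S]

/-- The likelihood ratio `L_X = dP₁ˣ / dP₀ˣ` of a private signal. -/
def signalLR (PX : Bool → Measure S) (s : S) : ℝ≥0∞ :=
  (PX true).rnDeriv (PX false) s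

/-- The private belief `P(θ = H₁ | X = s) = π₁ L_X(s) / (π₀ + π₁ L_X(s))`, which is
`(1 + (π₀ / π₁) / L_X(s))⁻¹` where `L_X(s) ≠ 0`. -/
def privateBelief (prior : Bool → ℝ) (PX : Bool → Measure S) (s : S) : ℝ :=
  prior true * (signalLR PX s).toReal / (prior false + prior true * (signalLR PX s).toReal)

/-- The private belief puts mass of exact order `r` within distance `r` of either certainty:
`P₀(belief ≤ r) = Θ(r)` and `P₁(belief ≥ 1 - r) = Θ(r)` as `r → 0+`. -/
structure HasLinearTails (prior : Bool → ℝ) (PX : Bool → Measure S) : Prop where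
  lower : (fun r : ℝ => (PX false).real {s | privateBelief prior PX s ≤ r}) =Θ[𝓝[>] 0]
    fun r : ℝ => r
  upper : (fun r : ℝ => (PX true).real {s | 1 - r ≤ privateBelief prior PX s}) =Θ[𝓝[>] 0]
    fun r : ℝ => r

/-- The threshold `π₀ / π₁` of the MAP test. -/
def mapThreshold (prior : Bool → ℝ) : ℝ≥0∞ :=
  ENNReal.ofReal (prior false / prior true)

/-- The MAP test of a node that has only its private signal. -/
def privateTest (prior : Bool → ℝ) (PX : Bool → Measure S) (s : S) : Bool :=
  open Classical in decide (mapThreshold prior < signalLR PX s)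

/-- The MAP test of a node that has its private signal `s` and one received decision `b`, where
`Q j` is the law of the received decision under `H_j`: decide `1` iff
`L_X(s) · Q₁(b) / Q₀(b) > π₀ / π₁`. -/
def relayTest (prior : Bool → ℝ) (PX : Bool → Measure S) (Q : Bool → Measure Bool)
    (s : S) (b : Bool) : Bool :=
  open Classical in decide (mapThreshold prior < signalLR PX s * (Q true {b} / Q false {b}))

/-- `tandemLaw prior PX i j` is the law under `H_j` of the decision of the node that has `i`
predecessors in a tandem network, when every node of the tandem applies the MAP test to its own
private signal and the decision of its immediate predecessor (the equilibrium strategy). -/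
def tandemLaw (prior : Bool → ℝ) (PX : Bool → Measure S) : ℕ → Bool → Measure Bool
  | 0 => fun j => (PX j).map (privateTest prior PX)
  | i + 1 => fun j => ((PX j).prod (tandemLaw prior PX i j)).map
      (fun p => relayTest prior PX (tandemLaw prior PX i) p.1 p.2)

/-- `n_k`: the largest `n` such that each of the nodes `a_{k - n²}, …, a_k` (there have to be that
many, i.e. `k - n² ≥ 1`) has memory size at least `n`. -/
def tandemLength (m : ℕ → ℕ) (k : ℕ) : ℕ :=
  Nat.findGreatest (fun n => n ^ 2 < k ∧ ∀ i, k - n ^ 2 ≤ i → i ≤ k → n ≤ m i) k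

theorem tandemLength_isGreatest (m : ℕ → ℕ) (k : ℕ) (hk : 1 ≤ k) :
    IsGreatest {n | n ^ 2 < k ∧ ∀ i, k - n ^ 2 ≤ i → i ≤ k → n ≤ m i} (tandemLength m k) := by
  constructor
  · exact Nat.findGreatest_spec
      (P := fun n => n ^ 2 < k ∧ ∀ i, k - n ^ 2 ≤ i → i ≤ k → n ≤ m i) (Nat.zero_le k)
      ⟨by simp; omega, fun _ _ _ => Nat.zero_le _⟩
  · intro n hn
    refine Nat.le_findGreatest ?_ hn
    have := hn.1
    nlinarith

/-- The nodes among the `n` immediate predecessors of `a_k` whose broadcast is not erased;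
`er i = true` means that the broadcast of `a_i` is erased. -/
def unerased (er : ℕ → Bool) (n k : ℕ) : Finset ℕ :=
  (Finset.Ico (k - n) k).filter (fun i => er i = false)

/-- The most recent node, among the `n` immediate predecessors of `a_k`, from which `a_k` receives
an unerased decision. -/
def latestUnerased (er : ℕ → Bool) (n k : ℕ) : Option ℕ :=
  if h : (unerased er n k).Nonempty then some ((unerased er n k).max' h) else none

/-- Backward search from `a_k`: the nodes `k = k₀ > k₁ > k₂ > …`, where `k_{i+1}` is the most
recent of the `n` immediate predecessors of `a_{k_i}` whose decision reaches `a_{k_i}`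
(`none` once the search has failed). -/
def backwardSearch (er : ℕ → Bool) (n k : ℕ) : ℕ → Option ℕ
  | 0 => some k
  | i + 1 => (backwardSearch er n k i).bind (latestUnerased er n)

/-- A tandem network of length `n` ending at `a_k` is found by the backward search. -/
def HasTandem (er : ℕ → Bool) (n k : ℕ) : Prop :=
  (backwardSearch er n k n).isSome

/-- The decision of node `a_k` when it is used as a tandem node with `i` tandem predecessors, found
by backward search among `n` immediate predecessors at each step: `a_k` applies the MAP test to its
private signal `x k` and the one decision it takes from the network.  (If the search fails, the node
where it fails relies on its private signal alone.) -/
def tandemDecision (prior : Bool → ℝ) (PX : Bool → Measure S) (x : ℕ → S) (er : ℕ → Bool)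
    (n : ℕ) : ℕ → ℕ → Bool
  | 0, k => privateTest prior PX (x k)
  | i + 1, k =>
    match latestUnerased er n k with
    | some k' => relayTest prior PX (tandemLaw prior PX i) (x k)
        (tandemDecision prior PX x er n i k')
    | none => privateTest prior PX (x k)

/-- The error probability `π₀ P₀(d = 1) + π₁ P₁(d = 0)` of a decision `d`. -/
def errorProb {Ω : Type*} [MeasurableSpace Ω] (prior : Bool → ℝ) (P : Bool → Measure Ω)
    (d : Ω → Bool) : ℝ :=
  prior false * (P false).real {ω | d ω = true} + prior true * (P true).real {ω | d ω = false}

/-- The random elements of the network under the two hypotheses: `X k` is the private signal of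
`a_k`, and `Z k = true` means that its broadcast is erased.  Under `H_j` the signals are i.i.d. with
law `PX j`; broadcasts go through a memoryless binary erasure channel, so that the erasures are
independent, independent of the signals, and `a_k`'s broadcast is erased with probability `q k`,
whatever its decision is. -/
structure IsModel {Ω : Type*} [MeasurableSpace Ω] (P : Bool → Measure Ω) (PX : Bool → Measure S)
    (q : ℕ → ℝ) (X : ℕ → Ω → S) (Z : ℕ → Ω → Bool) : Prop where
  measurable_signal : ∀ k, Measurable (X k)
  measurable_erasure : ∀ k, Measurable (Z k)
  signal_law : ∀ j k, 1 ≤ k → (P j).map (X k) = PX j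
  erasure_prob : ∀ j k, 1 ≤ k → (P j).real {ω | Z k ω = true} = q k
  indep_signal : ∀ j, iIndepFun X (P j)
  indep_erasure : ∀ j, iIndepFun Z (P j)
  indep_signal_erasure : ∀ j, IndepFun (fun ω k => X k ω) (fun ω k => Z k ω) (P j)

end

end ErasureNetwork

/-! Signals and erasures play separate roles: the erasures select which nodes form the tandem, the
signals determine what it decides. For a fixed erasure pattern on which the backward search
succeeds, the decision has law `tandemLaw prior PX n j`, whatever the pattern is. Integrating over
patterns makes the decision independent of success (`IsModel.real_hasTandem_inter`). So the error of
`a_k` is at least the tandem error times a lower bound for the success probability, and at most the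
tandem error plus the failure probabilities weighted by the prior. Failure forces a run of `n`
consecutive erasures among about `n²` positions, which has probability `O(n² (1 - ε)^n)`, negligible
against `1 / n` (`IsModel.exists_hasTandem_bounds`).

For the tandem itself, let `a`, `b` be its two error probabilities and `e = π₀ a + π₁ b`. Compare
the MAP test with merely copying the received decision. Overruling a received `1` when `L ≤ t₁ = π₀
a / (π₁ (1 - b))` gains `π₀ a F₀(t₁) - π₁ (1 - b) F₁(t₁)`, and a received `0` is symmetric. Linear
tails make `F₀(t)` of order `t` near `0` and `G₁(t)` of order `1 / t` near infinity, so the total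
gain is of exact order `e²` (`exists_error_decrement_bounds`). Then `1 / e` grows linearly along the
tandem (`exists_bounds_of_quadratic_decrement`), and `exists_tandemError_bounds` follows.

It remains to see that the tandem length is of order `min(k^σ, k^(1/2))`
(`exists_tandemLength_bounds`): the first bound is memory, the second is the condition `n² < k`. -/

namespace ErasureNetwork

/-! ### Real analysis: the error recursion -/

/-- A quadratic decrement makes a positive sequence decay like `1 / n`. -/
theorem exists_bounds_of_quadratic_decrement (e : ℕ → ℝ) (he : ∀ n, 0 < e n) (he1 : ∀ n, e n ≤ 1)
    {c C : ℝ} (hc : 0 < c) (hC : 0 < C) (hlow : ∀ n, c * e n ^ 2 ≤ e n - e (n + 1))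
    (hup : ∀ n, e n - e (n + 1) ≤ C * e n ^ 2) :
    ∃ a A : ℝ, 0 < a ∧ 0 < A ∧ ∀ n : ℕ, a ≤ (n + 1) * e n ∧ (n + 1) * e n ≤ A := by
  have hanti : Antitone e := antitone_nat_of_succ_le fun n => by
    have := hlow n
    have : 0 ≤ c * e n ^ 2 := by positivity
    linarith
  -- The discrete form of `(1/e)' = -e'/e²`: divide the decrement by `e n * e (n + 1)`, which is at
  -- most `e n ^ 2` by monotonicity.
  have hstep : ∀ n, (e n)⁻¹ + c ≤ (e (n + 1))⁻¹ := fun n => by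
    have h0 := he n
    have h1 := he (n + 1)
    have hle : e (n + 1) ≤ e n := hanti n.le_succ
    rw [← sub_nonneg]
    have : (e (n + 1))⁻¹ - ((e n)⁻¹ + c) = (e n - e (n + 1) - c * (e n * e (n + 1))) /
        (e n * e (n + 1)) := by field_simp; ring
    rw [this]
    refine div_nonneg ?_ (by positivity)
    have : c * (e n * e (n + 1)) ≤ c * (e n * e n) := by gcongr
    nlinarith [hlow n]
  -- The `1` in the minimum pays for the start, where only `(e 0)⁻¹ ≥ 1` is known.
  have hinv : ∀ n : ℕ, min c 1 * (n + 1) ≤ (e n)⁻¹ := fun n => by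
    induction n with
    | zero =>
      have : 1 ≤ (e 0)⁻¹ := (one_le_inv₀ (he 0)).2 (he1 0)
      simpa using Or.inr this
    | succ n ih =>
      have := hstep n
      have := min_le_left c 1
      push_cast
      linarith
  have hmin : 0 < min c 1 := lt_min hc one_pos
  have hupper : ∀ n : ℕ, (n + 1) * e n ≤ (min c 1)⁻¹ := fun n => by
    have h := mul_le_mul_of_nonneg_right (hinv n) (he n).le
    rw [inv_mul_cancel₀ (he n).ne'] at h
    rw [le_inv_comm₀ (mul_pos (by positivity) (he n)) hmin, ← one_div,
      le_div_iff₀ (mul_pos (by positivity) (he n))]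
    linarith
  -- From `N` on, one step at most halves `e`, so `e n * e (n + 1)` is comparable to `e n ^ 2` and
  -- the reciprocal grows by at most `2 * C`. Earlier terms are handled by monotonicity.
  obtain ⟨N, hN⟩ := exists_nat_ge ((min c 1)⁻¹ * (2 * C))
  have hsmall : ∀ n, N ≤ n → C * e n ≤ 1 / 2 := fun n hn => by
    have h1 := hupper n
    have h2 : (N : ℝ) ≤ n := by exact_mod_cast hn
    have h3 : ((n : ℝ) + 1) * e n * (2 * C) ≤ n + 1 := by
      calc ((n : ℝ) + 1) * e n * (2 * C) ≤ (min c 1)⁻¹ * (2 * C) := by gcongr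
        _ ≤ n + 1 := by linarith
    have h4 : (0 : ℝ) < n + 1 := by positivity
    have h5 : ((n : ℝ) + 1) * (e n * (2 * C)) ≤ (n + 1) * 1 := by linarith
    have := le_of_mul_le_mul_left h5 h4
    linarith
  have hstep' : ∀ n, N ≤ n → (e (n + 1))⁻¹ ≤ (e n)⁻¹ + 2 * C := fun n hn => by
    have h0 := he n
    have h1 := he (n + 1)
    have hs := hsmall n hn
    have hu := hup n
    rw [← sub_nonneg]
    have : (e n)⁻¹ + 2 * C - (e (n + 1))⁻¹ = (2 * C * (e n * e (n + 1)) - (e n - e (n + 1))) /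
        (e n * e (n + 1)) := by field_simp; ring
    rw [this]
    refine div_nonneg ?_ (by positivity)
    have h2 : e n / 2 ≤ e (n + 1) := by nlinarith
    have : C * e n * (e n / 2) ≤ C * e n * e (n + 1) := by gcongr
    nlinarith
  set B := max (e N)⁻¹ (2 * C) with hB
  have hBpos : 0 < B := lt_max_of_lt_right (by positivity)
  have hinv' : ∀ n : ℕ, (e n)⁻¹ ≤ B * (n + 1) := fun n => by
    rcases le_total n N with hn | hn
    · calc (e n)⁻¹ ≤ (e N)⁻¹ := inv_anti₀ (he N) (hanti hn)
        _ ≤ B := le_max_left _ _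
        _ ≤ B * (n + 1) := le_mul_of_one_le_right hBpos.le (by linarith [n.cast_nonneg (α := ℝ)])
    · induction n, hn using Nat.le_induction with
      | base =>
        exact (le_max_left _ _).trans
          (le_mul_of_one_le_right hBpos.le (by linarith [N.cast_nonneg (α := ℝ)]))
      | succ n hn ih =>
        have := hstep' n hn
        have : 2 * C ≤ B := le_max_right _ _
        push_cast
        linarith
  refine ⟨B⁻¹, (min c 1)⁻¹, by positivity, by positivity, fun n => ⟨?_, hupper n⟩⟩
  have h := mul_le_mul_of_nonneg_right (hinv' n) (he n).le
  rw [inv_mul_cancel₀ (he n).ne'] at h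
  rw [inv_le_iff_one_le_mul₀ hBpos]
  linarith

/-- One step of the equilibrium strategy reduces the error probability `e = π₀ a + π₁ b` by an
amount of exact order `e²`.  Here `F j` and `G j` are the distribution function and the tail
function of the likelihood ratio under `H_j`. -/
theorem exists_error_decrement_bounds (F G : Bool → ℝ → ℝ) {p₀ p₁ : ℝ} (hp₀ : 0 < p₀) (hp₁ : 0 < p₁)
    (hp₀' : p₀ ≤ 1) (hp₁' : p₁ ≤ 1)
    {c C : ℝ} (hc : 0 < c) (hC : 0 < C)
    (hF0 : ∀ j t, 0 ≤ F j t) (hF1 : ∀ j t, F j t ≤ 1)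
    (hG0 : ∀ j t, 0 ≤ G j t) (hG1 : ∀ j t, G j t ≤ 1)
    (hFl : ∀ t, 0 < t → c * min t 1 ≤ F false t) (hFu : ∀ t, 0 < t → F false t ≤ C * t)
    (hGl : ∀ t, 0 < t → c * min t⁻¹ 1 ≤ G true t) (hGu : ∀ t, 0 < t → G true t ≤ C * t⁻¹)
    (hFF : ∀ t, 0 < t → F true t ≤ t * F false t - t / 2 * F false (t / 2))
    (hGG : ∀ t, 0 < t → t * G false t ≤ G true t - 1 / 2 * G true (2 * t)) :
    ∃ k K : ℝ, 0 < k ∧ 0 < K ∧ ∀ a b t₀ t₁ a' b' : ℝ, 0 < a → a < 1 → 0 < b → b < 1 →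
      t₁ = p₀ * a / (p₁ * (1 - b)) → t₀ = p₀ * (1 - a) / (p₁ * b) →
      a' = a * (1 - F false t₁) + (1 - a) * G false t₀ →
      b' = (1 - b) * F true t₁ + b * (1 - G true t₀) →
      k * (p₀ * a + p₁ * b) ^ 2 ≤ (p₀ * a + p₁ * b) - (p₀ * a' + p₁ * b') ∧
      (p₀ * a + p₁ * b) - (p₀ * a' + p₁ * b') ≤ K * (p₀ * a + p₁ * b) ^ 2 := by
  -- contributions of the two received decisions
  have hA : ∀ a b t, 0 < a → b < 1 → 0 < b → a < 1 → t = p₀ * a / (p₁ * (1 - b)) →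
      c / 4 * (p₀ * a) ^ 2 ≤ p₀ * a * F false t - p₁ * (1 - b) * F true t := by
    intro a b t ha hb hb0 ha1 ht
    have hb' : 0 < 1 - b := by linarith
    have htp : 0 < t := by rw [ht]; positivity
    -- At `t` the two posterior weights balance, so the terms in `F false t` cancel and only the
    -- gain coming from likelihood ratios below `t / 2` survives.
    have hmul : p₁ * (1 - b) * t = p₀ * a := by rw [ht]; field_simp
    have h1 : p₁ * (1 - b) * F true t ≤ p₁ * (1 - b) * (t * F false t - t / 2 * F false (t / 2)) := by
      gcongr; exact hFF t htp
    have h2 : p₁ * (1 - b) * (t * F false t - t / 2 * F false (t / 2))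
        = p₀ * a * F false t - p₀ * a / 2 * F false (t / 2) := by
      rw [← hmul]; ring
    have h3 : p₀ * a ≤ t := by
      rw [← hmul]
      have : p₁ * (1 - b) ≤ 1 := mul_le_one₀ hp₁' hb'.le (by linarith)
      nlinarith
    have h4 : p₀ * a / 2 ≤ min (t / 2) 1 := le_min (by linarith) (by nlinarith)
    have h5 : c * (p₀ * a / 2) ≤ F false (t / 2) :=
      (mul_le_mul_of_nonneg_left h4 hc.le).trans (hFl _ (by positivity))
    have h6 : p₀ * a / 2 * (c * (p₀ * a / 2)) ≤ p₀ * a / 2 * F false (t / 2) := by gcongr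
    nlinarith
  have hB : ∀ a b t, 0 < a → b < 1 → 0 < b → a < 1 → t = p₀ * (1 - a) / (p₁ * b) →
      c / 4 * (p₁ * b) ^ 2 ≤ p₁ * b * G true t - p₀ * (1 - a) * G false t := by
    intro a b t ha hb hb0 ha1 ht
    have ha' : 0 < 1 - a := by linarith
    have htp : 0 < t := by rw [ht]; positivity
    have hmul : p₀ * (1 - a) = p₁ * b * t := by rw [ht]; field_simp
    have h1 : p₁ * b * (t * G false t) ≤ p₁ * b * (G true t - 1 / 2 * G true (2 * t)) := by
      gcongr; exact hGG t htp
    have h3 : p₁ * b / 2 ≤ (2 * t)⁻¹ := by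
      rw [le_inv_comm₀ (by positivity) (by positivity), ← one_div, le_div_iff₀ (by positivity)]
      have : p₀ * (1 - a) ≤ 1 := mul_le_one₀ hp₀' ha'.le (by linarith)
      linarith
    have h4 : p₁ * b / 2 ≤ min (2 * t)⁻¹ 1 := le_min h3 (by nlinarith)
    have h5 : c * (p₁ * b / 2) ≤ G true (2 * t) :=
      (mul_le_mul_of_nonneg_left h4 hc.le).trans (hGl _ (by positivity))
    have h6 : p₁ * b / 2 * (c * (p₁ * b / 2)) ≤ p₁ * b / 2 * G true (2 * t) := by gcongr
    rw [hmul]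
    nlinarith
  have hA' : ∀ a b t, 0 < a → b < 1 → 0 < b → a < 1 → t = p₀ * a / (p₁ * (1 - b)) →
      p₀ * a * F false t ≤ 2 * (C + 1) / p₁ * (p₀ * a + p₁ * b) ^ 2 := by
    intro a b t ha hb hb0 ha1 ht
    have hb' : 0 < 1 - b := by linarith
    have htp : 0 < t := by rw [ht]; positivity
    have h0 : 0 < p₀ * a := by positivity
    have h0' : 0 < p₁ * b := by positivity
    -- For `b` near `1` the threshold `t` need not be of order `a`. In that case `p₁ * b` is bounded
    -- below, and the trivial bound `p₀ * a` is already of order `(p₀ * a) * (p₁ * b)`.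
    rcases le_total b (1 / 2) with h | h
    · have h1 : t ≤ 2 / p₁ * (p₀ * a) := by
        rw [ht, div_le_iff₀ (by positivity)]
        have : 2 / p₁ * (p₀ * a) * (p₁ * (1 - b)) = p₀ * a * (2 * (1 - b)) := by field_simp
        rw [this]
        nlinarith
      calc p₀ * a * F false t ≤ p₀ * a * (C * (2 / p₁ * (p₀ * a))) := by
            gcongr; exact (hFu t htp).trans (by gcongr)
        _ = 2 * C / p₁ * (p₀ * a) ^ 2 := by ring
        _ ≤ 2 * (C + 1) / p₁ * (p₀ * a + p₁ * b) ^ 2 := by gcongr <;> linarith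
    · have h1 : p₀ * a * F false t ≤ p₀ * a := mul_le_of_le_one_right h0.le (hF1 _ _)
      have h2 : p₀ * a ≤ 2 / p₁ * ((p₀ * a) * (p₁ * b)) := by
        have : 2 / p₁ * ((p₀ * a) * (p₁ * b)) = p₀ * a * (2 * b) := by field_simp
        rw [this]
        nlinarith
      calc p₀ * a * F false t ≤ 2 / p₁ * ((p₀ * a) * (p₁ * b)) := h1.trans h2
        _ ≤ 2 * (C + 1) / p₁ * (p₀ * a + p₁ * b) ^ 2 := by
          gcongr
          · linarith
          · nlinarith
  have hB' : ∀ a b t, 0 < a → b < 1 → 0 < b → a < 1 → t = p₀ * (1 - a) / (p₁ * b) →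
      p₁ * b * G true t ≤ 2 * (C + 1) / p₀ * (p₀ * a + p₁ * b) ^ 2 := by
    intro a b t ha hb hb0 ha1 ht
    have ha' : 0 < 1 - a := by linarith
    have htp : 0 < t := by rw [ht]; positivity
    have h0 : 0 < p₀ * a := by positivity
    have h0' : 0 < p₁ * b := by positivity
    rcases le_total a (1 / 2) with h | h
    · have h1 : t⁻¹ ≤ 2 / p₀ * (p₁ * b) := by
        rw [ht, inv_div, div_le_iff₀ (by positivity)]
        have : 2 / p₀ * (p₁ * b) * (p₀ * (1 - a)) = p₁ * b * (2 * (1 - a)) := by field_simp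
        rw [this]
        nlinarith
      calc p₁ * b * G true t ≤ p₁ * b * (C * (2 / p₀ * (p₁ * b))) := by
            gcongr; exact (hGu t htp).trans (by gcongr)
        _ = 2 * C / p₀ * (p₁ * b) ^ 2 := by ring
        _ ≤ 2 * (C + 1) / p₀ * (p₀ * a + p₁ * b) ^ 2 := by gcongr <;> linarith
    · have h1 : p₁ * b * G true t ≤ p₁ * b := mul_le_of_le_one_right h0'.le (hG1 _ _)
      have h2 : p₁ * b ≤ 2 / p₀ * ((p₁ * b) * (p₀ * a)) := by
        have : 2 / p₀ * ((p₁ * b) * (p₀ * a)) = p₁ * b * (2 * a) := by field_simp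
        rw [this]
        nlinarith
      calc p₁ * b * G true t ≤ 2 / p₀ * ((p₁ * b) * (p₀ * a)) := h1.trans h2
        _ ≤ 2 * (C + 1) / p₀ * (p₀ * a + p₁ * b) ^ 2 := by
          gcongr
          · linarith
          · nlinarith
  -- The passage from `c / 4` to `c / 8` is `(x + y)² ≤ 2 (x² + y²)` with `x = p₀ * a`, `y = p₁ *
  -- b`.
  refine ⟨c / 8, 2 * (C + 1) / p₁ + 2 * (C + 1) / p₀, by positivity, by positivity, ?_⟩
  intro a b t₀ t₁ a' b' ha ha1 hb hb1 ht₁ ht₀ ha' hb'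
  have e1 : (p₀ * a + p₁ * b) - (p₀ * a' + p₁ * b')
      = (p₀ * a * F false t₁ - p₁ * (1 - b) * F true t₁)
        + (p₁ * b * G true t₀ - p₀ * (1 - a) * G false t₀) := by
    rw [ha', hb']; ring
  have l1 := hA a b t₁ ha hb1 hb ha1 ht₁
  have l2 := hB a b t₀ ha hb1 hb ha1 ht₀
  have u1 := hA' a b t₁ ha hb1 hb ha1 ht₁
  have u2 := hB' a b t₀ ha hb1 hb ha1 ht₀
  have n1 : 0 ≤ p₁ * (1 - b) * F true t₁ :=
    mul_nonneg (mul_nonneg hp₁.le (by linarith)) (hF0 _ _)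
  have n2 : 0 ≤ p₀ * (1 - a) * G false t₀ :=
    mul_nonneg (mul_nonneg hp₀.le (by linarith)) (hG0 _ _)
  rw [e1]
  constructor
  · nlinarith [mul_nonneg hc.le (sq_nonneg (p₀ * a - p₁ * b))]
  · rw [add_mul]; linarith

end ErasureNetwork

/-! ### Linear tails as bounds on the law of the likelihood ratio -/

namespace ErasureNetwork

/-- A bounded monotone function that is of exact order `r` at `0+` is so on `(0, 1]`. -/
theorem exists_linear_bounds_of_isTheta {G : ℝ → ℝ} (hmono : Monotone G) (h0 : ∀ r, 0 ≤ G r)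
    (h1 : ∀ r, G r ≤ 1) (hG : G =Θ[𝓝[>] 0] fun r : ℝ => r) :
    ∃ c C : ℝ, 0 < c ∧ 0 < C ∧ ∀ r, 0 < r → r ≤ 1 → c * r ≤ G r ∧ G r ≤ C * r := by
  obtain ⟨C, hC, hCG⟩ := hG.1.exists_pos
  obtain ⟨K, hK, hKG⟩ := hG.2.exists_pos
  obtain ⟨δ, hδ, hsub⟩ := (mem_nhdsGT_iff_exists_Ioo_subset' (one_pos (α := ℝ))).1
    (inter_mem hCG.bound hKG.bound)
  rw [Set.mem_Ioi] at hδ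
  have key : ∀ r, 0 < r → r < δ → r ≤ K * G r ∧ G r ≤ C * r := fun r hr hrδ => by
    have := hsub ⟨hr, hrδ⟩
    simp only [Set.mem_inter_iff, Set.mem_ofPred_eq, Real.norm_eq_abs, abs_of_pos hr,
      abs_of_nonneg (h0 r)] at this
    exact ⟨this.2, this.1⟩
  -- A point strictly inside the range of the asymptotic bounds; beyond it, monotonicity and `G ≤ 1`
  -- give cruder linear bounds up to `1`.
  set η := min (δ / 2) 1 with hη
  have hη0 : 0 < η := by positivity
  have hηδ : η < δ := (min_le_left _ _).trans_lt (by linarith)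
  have hη1 : η ≤ 1 := min_le_right _ _
  refine ⟨K⁻¹ * η, C + η⁻¹, by positivity, by positivity, fun r hr hr1 => ?_⟩
  rcases lt_or_ge r η with h | h
  · obtain ⟨k1, k2⟩ := key r hr (h.trans hηδ)
    constructor
    · calc K⁻¹ * η * r ≤ K⁻¹ * 1 * r := by gcongr
        _ ≤ G r := by rw [mul_one, inv_mul_le_iff₀ hK]; exact k1
    · refine k2.trans ?_
      gcongr
      linarith [inv_pos.2 hη0]
  · obtain ⟨k1, -⟩ := key η hη0 hηδ
    constructor
    · calc K⁻¹ * η * r ≤ K⁻¹ * η * 1 := by gcongr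
        _ ≤ G η := by rw [mul_one, inv_mul_le_iff₀ hK]; exact k1
        _ ≤ G r := hmono h
    · refine (h1 r).trans ?_
      calc 1 = η⁻¹ * η := (inv_mul_cancel₀ hη0.ne').symm
        _ ≤ η⁻¹ * r := by gcongr
        _ ≤ (C + η⁻¹) * r := by gcongr; linarith

variable {S : Type*} [MeasurableSpace S]

/-- The distribution function of the likelihood ratio under `H_j`. -/
noncomputable def lrCDF (PX : Bool → Measure S) (j : Bool) (t : ℝ) : ℝ :=
  (PX j).real {s | signalLR PX s ≤ ENNReal.ofReal t}

/-- The tail function of the likelihood ratio under `H_j`. -/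
noncomputable def lrTail (PX : Bool → Measure S) (j : Bool) (t : ℝ) : ℝ :=
  (PX j).real {s | ENNReal.ofReal t < signalLR PX s}

theorem measurable_signalLR (PX : Bool → Measure S) : Measurable (signalLR PX) :=
  Measure.measurable_rnDeriv _ _

/-- The belief is an increasing function of the likelihood ratio, and the left-hand threshold is its
value at `t`. Finiteness matters because `toReal` sends `∞` to `0`. -/
theorem privateBelief_le_iff {prior : Bool → ℝ} (PX : Bool → Measure S)
    (hprior : ∀ j, 0 < prior j) {s : S} (hs : signalLR PX s < ∞)
    {t : ℝ} (ht : 0 < t) :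
    privateBelief prior PX s ≤ prior true * t / (prior false + prior true * t) ↔
      signalLR PX s ≤ ENNReal.ofReal t := by
  have h0 := hprior false
  have h1 := hprior true
  have hl : 0 ≤ (signalLR PX s).toReal := ENNReal.toReal_nonneg
  rw [ENNReal.le_ofReal_iff_toReal_le hs.ne ht.le, privateBelief,
    div_le_div_iff₀ (by positivity) (by positivity)]
  have : 0 < prior true * prior false := by positivity
  constructor
  · intro h
    by_contra hlt
    push Not at hlt
    nlinarith
  · intro h
    nlinarith

theorem le_privateBelief_iff {prior : Bool → ℝ} (PX : Bool → Measure S)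
    (hprior : ∀ j, 0 < prior j) {s : S} (hs : signalLR PX s < ∞)
    {t : ℝ} (ht : 0 < t) :
    1 - prior false / (prior false + prior true * t) ≤ privateBelief prior PX s ↔
      ENNReal.ofReal t ≤ signalLR PX s := by
  have h0 := hprior false
  have h1 := hprior true
  have hl : 0 ≤ (signalLR PX s).toReal := ENNReal.toReal_nonneg
  have e : 1 - prior false / (prior false + prior true * t)
      = prior true * t / (prior false + prior true * t) := by
    have : prior false + prior true * t ≠ 0 := by positivity
    field_simp
    ring
  rw [e, ENNReal.ofReal_le_iff_le_toReal hs.ne, privateBelief,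
    div_le_div_iff₀ (by positivity) (by positivity)]
  have : 0 < prior true * prior false := by positivity
  constructor
  · intro h
    by_contra hlt
    push Not at hlt
    nlinarith
  · intro h
    nlinarith

section
variable (PX : Bool → Measure S) [∀ j, IsProbabilityMeasure (PX j)]

theorem lrCDF_add_lrTail (j : Bool) (t : ℝ) : lrCDF PX j t + lrTail PX j t = 1 := by
  have h := probReal_add_probReal_compl (μ := PX j)
    (s := {s | signalLR PX s ≤ ENNReal.ofReal t})
    (measurableSet_le (measurable_signalLR PX) measurable_const)
  rwa [show {s | signalLR PX s ≤ ENNReal.ofReal t}ᶜ = {s | ENNReal.ofReal t < signalLR PX s} by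
    ext; simp] at h

theorem ae_signalLR_lt_top (hPX₁₀ : PX true ≪ PX false) (j : Bool) :
    ∀ᵐ s ∂(PX j), signalLR PX s < ∞ := by
  have h : ∀ᵐ s ∂(PX false), signalLR PX s < ∞ := Measure.rnDeriv_lt_top _ _
  cases j
  · exact h
  · exact hPX₁₀.ae_le h

theorem real_true_le_mul (hPX₁₀ : PX true ≪ PX false) {A : Set S}
    {t : ℝ} (ht : 0 ≤ t) (hAt : ∀ s ∈ A, signalLR PX s ≤ ENNReal.ofReal t) :
    (PX true).real A ≤ t * (PX false).real A := by
  have h : PX true A ≤ ENNReal.ofReal t * PX false A := by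
    rw [← Measure.setLIntegral_rnDeriv hPX₁₀ A, ← setLIntegral_const]
    exact setLIntegral_mono measurable_const hAt
  have := ENNReal.toReal_mono (by finiteness) h
  rwa [ENNReal.toReal_mul, ENNReal.toReal_ofReal ht] at this

theorem mul_le_real_true (hPX₁₀ : PX true ≪ PX false) {A : Set S}
    {t : ℝ} (ht : 0 ≤ t) (hAt : ∀ s ∈ A, ENNReal.ofReal t ≤ signalLR PX s) :
    t * (PX false).real A ≤ (PX true).real A := by
  have h : ENNReal.ofReal t * PX false A ≤ PX true A := by
    rw [← Measure.setLIntegral_rnDeriv hPX₁₀ A, ← setLIntegral_const]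
    exact setLIntegral_mono (measurable_signalLR PX) hAt
  have := ENNReal.toReal_mono (by finiteness) h
  rwa [ENNReal.toReal_mul, ENNReal.toReal_ofReal ht] at this

/-- Split the event at `t / 2` and bound the density by `t` above the cut and by `t / 2` below it.
The subtracted term makes the gain of the MAP test quantitative; the plain bound `t * lrCDF PX false
t` would only show that the error does not increase. -/
theorem lrCDF_true_le (hPX₁₀ : PX true ≪ PX false) {t : ℝ} (ht : 0 < t) :
    lrCDF PX true t ≤ t * lrCDF PX false t - t / 2 * lrCDF PX false (t / 2) := by
  have hm : ∀ u : ℝ, MeasurableSet {s | signalLR PX s ≤ ENNReal.ofReal u} := fun u =>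
    measurableSet_le (measurable_signalLR PX) measurable_const
  have hsub : {s | signalLR PX s ≤ ENNReal.ofReal (t / 2)}
      ⊆ {s | signalLR PX s ≤ ENNReal.ofReal t} := fun s hs =>
    le_trans (Set.mem_ofPred.1 hs) (ENNReal.ofReal_le_ofReal (by linarith))
  have hsplit : ∀ j, (PX j).real ({s | signalLR PX s ≤ ENNReal.ofReal t} \
      {s | signalLR PX s ≤ ENNReal.ofReal (t / 2)}) = lrCDF PX j t - lrCDF PX j (t / 2) :=
    fun j => measureReal_sdiff hsub (hm _)
  have h1 := real_true_le_mul PX hPX₁₀ (A := {s | signalLR PX s ≤ ENNReal.ofReal t} \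
    {s | signalLR PX s ≤ ENNReal.ofReal (t / 2)}) ht.le (fun s hs => hs.1)
  have h2 := real_true_le_mul PX hPX₁₀ (A := {s | signalLR PX s ≤ ENNReal.ofReal (t / 2)})
    (by linarith) (fun s hs => hs)
  rw [hsplit, hsplit] at h1
  change lrCDF PX true (t / 2) ≤ t / 2 * lrCDF PX false (t / 2) at h2
  linarith

/-- The mirror image, cutting at `2 * t`, beyond which the density is at least `2 * t`. -/
theorem mul_lrTail_false_le (hPX₁₀ : PX true ≪ PX false) {t : ℝ} (ht : 0 < t) :
    t * lrTail PX false t ≤ lrTail PX true t - 1 / 2 * lrTail PX true (2 * t) := by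
  have hm : ∀ u : ℝ, MeasurableSet {s | ENNReal.ofReal u < signalLR PX s} := fun u =>
    measurableSet_lt measurable_const (measurable_signalLR PX)
  have hsub : {s | ENNReal.ofReal (2 * t) < signalLR PX s}
      ⊆ {s | ENNReal.ofReal t < signalLR PX s} := fun s hs =>
    lt_of_le_of_lt (ENNReal.ofReal_le_ofReal (by linarith)) (Set.mem_ofPred.1 hs)
  have hsplit : ∀ j, (PX j).real ({s | ENNReal.ofReal t < signalLR PX s} \
      {s | ENNReal.ofReal (2 * t) < signalLR PX s}) = lrTail PX j t - lrTail PX j (2 * t) :=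
    fun j => measureReal_sdiff hsub (hm _)
  have h1 := mul_le_real_true PX hPX₁₀ (A := {s | ENNReal.ofReal t < signalLR PX s} \
    {s | ENNReal.ofReal (2 * t) < signalLR PX s}) ht.le (fun s hs => le_of_lt hs.1)
  have h2 := mul_le_real_true PX hPX₁₀ (A := {s | ENNReal.ofReal (2 * t) < signalLR PX s})
    (by linarith) (fun s hs => le_of_lt hs)
  rw [hsplit, hsplit] at h1
  change 2 * t * lrTail PX false (2 * t) ≤ lrTail PX true (2 * t) at h2
  linarith

variable {prior : Bool → ℝ}

/-- Substitute for `r` the belief at likelihood ratio `t`: it is of order `t` for `t ≤ 1` and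
bounded below for `t ≥ 1`, whence the truncation `min t 1`. -/
theorem exists_lrCDF_bounds (hprior : ∀ j, 0 < prior j) (hsum : prior false + prior true = 1)
    (hPX₁₀ : PX true ≪ PX false) (htails : HasLinearTails prior PX) :
    ∃ c C : ℝ, 0 < c ∧ 0 < C ∧ ∀ t, 0 < t →
      c * min t 1 ≤ lrCDF PX false t ∧ lrCDF PX false t ≤ C * t := by
  obtain ⟨c, C, hc, hC, h⟩ := exists_linear_bounds_of_isTheta
    (G := fun r => (PX false).real {s | privateBelief prior PX s ≤ r})
    (fun r r' hr => measureReal_mono fun s hs => le_trans hs hr)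
    (fun _ => measureReal_nonneg) (fun _ => measureReal_le_one) htails.lower
  have h0 := hprior false
  have h1 := hprior true
  refine ⟨c * prior true, C * (prior true / prior false), by positivity, by positivity,
    fun t ht => ?_⟩
  have hD : 0 < prior false + prior true * t := by positivity
  set r := prior true * t / (prior false + prior true * t) with hr
  have hr0 : 0 < r := by positivity
  have hr1 : r ≤ 1 := by rw [hr, div_le_one hD]; linarith
  have heq : lrCDF PX false t = (PX false).real {s | privateBelief prior PX s ≤ r} := by
    refine measureReal_congr ?_
    filter_upwards [ae_signalLR_lt_top PX hPX₁₀ false] with s hs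
    exact propext (privateBelief_le_iff PX hprior hs ht).symm
  obtain ⟨hl, hu⟩ := h r hr0 hr1
  rw [heq]
  constructor
  · refine le_trans ?_ hl
    rw [mul_assoc]
    refine mul_le_mul_of_nonneg_left ?_ hc.le
    rw [hr, le_div_iff₀ hD]
    rcases le_total t 1 with h | h
    · rw [min_eq_left h]
      have : prior true * t * (prior false + prior true * t) ≤ prior true * t * 1 := by
        gcongr; nlinarith
      linarith
    · rw [min_eq_right h]
      have : prior false + prior true * t ≤ t := by nlinarith
      nlinarith
  · refine hu.trans ?_
    rw [mul_assoc]
    refine mul_le_mul_of_nonneg_left ?_ hC.le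
    rw [hr, div_mul_eq_mul_div]
    gcongr
    have : 0 < prior true * t := by positivity
    linarith

theorem exists_lrTail_bounds (hprior : ∀ j, 0 < prior j) (hsum : prior false + prior true = 1)
    (hPX₁₀ : PX true ≪ PX false) (htails : HasLinearTails prior PX) :
    ∃ c C : ℝ, 0 < c ∧ 0 < C ∧ ∀ t, 0 < t →
      c * min t⁻¹ 1 ≤ lrTail PX true t ∧ lrTail PX true t ≤ C * t⁻¹ := by
  obtain ⟨c, C, hc, hC, h⟩ := exists_linear_bounds_of_isTheta
    (G := fun r => (PX true).real {s | 1 - r ≤ privateBelief prior PX s})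
    (fun r r' hr => measureReal_mono fun s hs => le_trans (sub_le_sub_left hr 1) hs)
    (fun _ => measureReal_nonneg) (fun _ => measureReal_le_one) htails.upper
  have h0 := hprior false
  have h1 := hprior true
  -- The tail hypothesis concerns a closed event, so the bounds come first for `t ≤ L`.
  have key : ∀ t, 0 < t → c * prior false * min t⁻¹ 1 ≤
        (PX true).real {s | ENNReal.ofReal t ≤ signalLR PX s} ∧
      (PX true).real {s | ENNReal.ofReal t ≤ signalLR PX s} ≤
        C * (prior false / prior true) * t⁻¹ := by
    intro t ht
    have hD : 0 < prior false + prior true * t := by positivity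
    set r := prior false / (prior false + prior true * t) with hr
    have hr0 : 0 < r := by positivity
    have hpt : 0 < prior true * t := by positivity
    have hr1 : r ≤ 1 := by rw [hr, div_le_one hD]; linarith
    have heq : (PX true).real {s | ENNReal.ofReal t ≤ signalLR PX s}
        = (PX true).real {s | 1 - r ≤ privateBelief prior PX s} := by
      refine measureReal_congr ?_
      filter_upwards [ae_signalLR_lt_top PX hPX₁₀ true] with s hs
      exact propext (le_privateBelief_iff PX hprior hs ht).symm
    obtain ⟨hl, hu⟩ := h r hr0 hr1
    rw [heq]
    constructor
    · refine le_trans ?_ hl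
      rw [mul_assoc]
      refine mul_le_mul_of_nonneg_left ?_ hc.le
      rw [hr, div_eq_mul_inv]
      refine mul_le_mul_of_nonneg_left ?_ h0.le
      rcases le_total t 1 with h | h
      · exact (min_le_right _ _).trans ((one_le_inv₀ hD).2 (by nlinarith))
      · exact (min_le_left _ _).trans (inv_anti₀ hD (by nlinarith))
    · refine hu.trans ?_
      rw [mul_assoc]
      refine mul_le_mul_of_nonneg_left ?_ hC.le
      rw [hr, ← div_eq_mul_inv, div_div]
      gcongr
      linarith
  refine ⟨c * prior false / 2, C * (prior false / prior true), by positivity, by positivity,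
    fun t ht => ⟨?_, ?_⟩⟩
  -- To reach the strict inequality of `lrTail`, use the closed event at `2 * t`; this costs the
  -- factor `2` in the constant.
  · have h2 : (PX true).real {s | ENNReal.ofReal (2 * t) ≤ signalLR PX s} ≤ lrTail PX true t :=
      measureReal_mono fun s (hs : _ ≤ _) =>
        lt_of_lt_of_le ((ENNReal.ofReal_lt_ofReal_iff (by positivity)).2 (by linarith)) hs
    refine le_trans ?_ ((key (2 * t) (by positivity)).1.trans h2)
    have : min t⁻¹ 1 ≤ 2 * min (2 * t)⁻¹ 1 := by
      rw [mul_min_of_nonneg _ _ zero_le_two, mul_inv, mul_inv_cancel_left₀ two_ne_zero]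
      exact min_le_min le_rfl (by norm_num)
    have h3 := mul_le_mul_of_nonneg_left this (by positivity : 0 ≤ c * prior false)
    linarith
  · refine le_trans (measureReal_mono fun s hs => ?_) (key t ht).2
    exact le_of_lt (Set.mem_ofPred.1 hs)

end

end ErasureNetwork

/-! ### Law and error probability of the tandem -/

namespace ErasureNetwork

variable {S : Type*} [MeasurableSpace S]

theorem privateTest_eq_true_iff (prior : Bool → ℝ) (PX : Bool → Measure S) (s : S) :
    privateTest prior PX s = true ↔
      ENNReal.ofReal (prior false / prior true) < signalLR PX s := by
  rw [privateTest, decide_eq_true_iff, mapThreshold]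

theorem measurable_privateTest (prior : Bool → ℝ) (PX : Bool → Measure S) :
    Measurable (privateTest prior PX) := by
  refine measurable_to_bool ?_
  have : privateTest prior PX ⁻¹' {true} =
      {s | ENNReal.ofReal (prior false / prior true) < signalLR PX s} := by
    ext s; simp [privateTest_eq_true_iff]
  rw [this]
  exact measurableSet_lt measurable_const (measurable_signalLR PX)

theorem measurable_relayTest (prior : Bool → ℝ) (PX : Bool → Measure S)
    (Q : Bool → Measure Bool) :
    Measurable fun p : S × Bool => relayTest prior PX Q p.1 p.2 := by
  refine measurable_from_prod_countable_left fun b => measurable_to_bool ?_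
  have : (fun s => relayTest prior PX Q s b) ⁻¹' {true} =
      {s | mapThreshold prior < signalLR PX s * (Q true {b} / Q false {b})} := by
    ext s; simp [relayTest]
  rw [this]
  exact measurableSet_lt measurable_const ((measurable_signalLR PX).mul_const _)

/-- Positivity of both probabilities keeps the `ℝ≥0∞` quotient away from `0` and `∞`, so it can be
moved across the inequality to give a real threshold. -/
theorem relayTest_eq_true_iff {prior : Bool → ℝ} (hprior : ∀ j, 0 < prior j)
    (PX : Bool → Measure S) (Q : Bool → Measure Bool) [∀ j, IsProbabilityMeasure (Q j)] (s : S)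
    {b : Bool} (h₀ : 0 < (Q false).real {b}) (h₁ : 0 < (Q true).real {b}) :
    relayTest prior PX Q s b = true ↔
      ENNReal.ofReal (prior false * (Q false).real {b} / (prior true * (Q true).real {b})) <
        signalLR PX s := by
  have hp := hprior true
  have e₀ : Q false {b} = ENNReal.ofReal ((Q false).real {b}) := (ofReal_measureReal).symm
  have e₁ : Q true {b} = ENNReal.ofReal ((Q true).real {b}) := (ofReal_measureReal).symm
  have hr : 0 < (Q true).real {b} / (Q false).real {b} := by positivity
  rw [relayTest, decide_eq_true_iff, mapThreshold, e₀, e₁, ← ENNReal.ofReal_div_of_pos h₀,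
    ← ENNReal.div_lt_iff (Or.inl (by simpa using hr)) (Or.inl ENNReal.ofReal_ne_top),
    ← ENNReal.ofReal_div_of_pos hr, div_div_div_eq]

theorem tandemLaw_zero_real (prior : Bool → ℝ) (PX : Bool → Measure S) (j b : Bool) :
    (tandemLaw prior PX 0 j).real {b} = (PX j).real {s | privateTest prior PX s = b} := by
  change ((PX j).map (privateTest prior PX)).real {b} = _
  rw [map_measureReal_apply (measurable_privateTest prior PX) (measurableSet_singleton b)]
  rfl

section
variable (prior : Bool → ℝ) (PX : Bool → Measure S) [∀ j, IsProbabilityMeasure (PX j)]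

instance isProbabilityMeasure_tandemLaw (i : ℕ) (j : Bool) :
    IsProbabilityMeasure (tandemLaw prior PX i j) := by
  induction i with
  | zero => exact Measure.isProbabilityMeasure_map (measurable_privateTest prior PX).aemeasurable
  | succ i ih =>
    exact Measure.isProbabilityMeasure_map (measurable_relayTest prior PX _).aemeasurable

theorem tandemLaw_succ_real (i : ℕ) (j b : Bool) :
    (tandemLaw prior PX (i + 1) j).real {b} =
      (PX j).real {s | relayTest prior PX (tandemLaw prior PX i) s true = b} *
        (tandemLaw prior PX i j).real {true} +
      (PX j).real {s | relayTest prior PX (tandemLaw prior PX i) s false = b} *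
        (tandemLaw prior PX i j).real {false} := by
  set Q := tandemLaw prior PX i with hQ
  have hmeas := measurable_relayTest prior PX Q
  change (((PX j).prod (Q j)).map (fun p => relayTest prior PX Q p.1 p.2)).real {b} = _
  rw [map_measureReal_apply hmeas (measurableSet_singleton b)]
  have hsec : ∀ c, MeasurableSet {s | relayTest prior PX Q s c = b} := fun c =>
    (hmeas.comp measurable_prodMk_right) (measurableSet_singleton b)
  have hset : (fun p : S × Bool => relayTest prior PX Q p.1 p.2) ⁻¹' {b} =
      ({s | relayTest prior PX Q s true = b} ×ˢ {true}) ∪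
      ({s | relayTest prior PX Q s false = b} ×ˢ {false}) := by
    ext ⟨s, c⟩
    cases c <;> simp
  rw [hset, measureReal_union ?_ ((hsec false).prod (measurableSet_singleton _)),
    measureReal_prod_prod, measureReal_prod_prod]
  refine Set.disjoint_left.2 ?_
  rintro ⟨s, c⟩ h h'
  simp only [Set.mem_prod, Set.mem_singleton_iff] at h h'
  simp [h.2] at h'

variable {prior PX}

/-- Linear tails control `lrCDF` only under `H₀` and `lrTail` only under `H₁`; absolute continuity
carries positivity to the other hypothesis. -/
theorem lrCDF_false_pos_imp (hPX₀₁ : PX false ≪ PX true) {t : ℝ} (h : 0 < lrCDF PX false t) :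
    0 < lrCDF PX true t := by
  refine measureReal_nonneg.lt_of_ne' fun h0 => h.ne' ?_
  rw [measureReal_eq_zero_iff] at h0
  exact (measureReal_eq_zero_iff).2 (hPX₀₁ h0)

theorem lrTail_true_pos_imp (hPX₁₀ : PX true ≪ PX false) {t : ℝ} (h : 0 < lrTail PX true t) :
    0 < lrTail PX false t := by
  refine measureReal_nonneg.lt_of_ne' fun h0 => h.ne' ?_
  rw [measureReal_eq_zero_iff] at h0
  exact (measureReal_eq_zero_iff).2 (hPX₁₀ h0)

theorem tandemLaw_real_false_add_true (i : ℕ) (j : Bool) :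
    (tandemLaw prior PX i j).real {false} + (tandemLaw prior PX i j).real {true} = 1 := by
  rw [← measureReal_union (by simp) (measurableSet_singleton _), ← probReal_univ
    (μ := tandemLaw prior PX i j)]
  congr 1
  ext b; cases b <;> simp

/-- Recursion for the law of a tandem decision in terms of the law of the likelihood ratio. -/
theorem tandemLaw_succ_real_true (hprior : ∀ j, 0 < prior j) (i : ℕ)
    (hpos : ∀ j b, 0 < (tandemLaw prior PX i j).real {b}) (j : Bool) :
    (tandemLaw prior PX (i + 1) j).real {true} =
      lrTail PX j (prior false * (tandemLaw prior PX i false).real {true} /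
        (prior true * (tandemLaw prior PX i true).real {true})) *
          (tandemLaw prior PX i j).real {true} +
      lrTail PX j (prior false * (tandemLaw prior PX i false).real {false} /
        (prior true * (tandemLaw prior PX i true).real {false})) *
          (tandemLaw prior PX i j).real {false} := by
  rw [tandemLaw_succ_real]
  simp only [relayTest_eq_true_iff hprior PX (tandemLaw prior PX i) _ (hpos false _) (hpos true _)]
  rfl

/-- Since the likelihood ratio has mass on both sides of every positive threshold, no received
decision is ever followed blindly. The induction treats all `j` and `b` together because the next
thresholds involve all four probabilities. -/
theorem tandemLaw_real_pos (hprior : ∀ j, 0 < prior j)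
    (hF : ∀ j t, 0 < t → 0 < lrCDF PX j t) (hG : ∀ j t, 0 < t → 0 < lrTail PX j t) (i : ℕ)
    (j b : Bool) : 0 < (tandemLaw prior PX i j).real {b} := by
  have hsum := fun i => tandemLaw_real_false_add_true (prior := prior) (PX := PX) i j
  have h0 := hprior false
  have h1 := hprior true
  induction i generalizing j b with
  | zero =>
    have htrue : (tandemLaw prior PX 0 j).real {true} =
        lrTail PX j (prior false / prior true) := by
      rw [tandemLaw_zero_real]
      simp only [privateTest_eq_true_iff]
      rfl
    have hp : 0 < prior false / prior true := by positivity
    have hadd := lrCDF_add_lrTail PX j (prior false / prior true)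
    have := hF j _ hp
    have := hG j _ hp
    have := hsum 0
    cases b <;> linarith
  | succ i ih =>
    have ih' : ∀ j b, 0 < (tandemLaw prior PX i j).real {b} := fun j b =>
      ih j b fun i => tandemLaw_real_false_add_true i j
    have e := tandemLaw_succ_real_true hprior i ih' j
    set t₁ := prior false * (tandemLaw prior PX i false).real {true} /
        (prior true * (tandemLaw prior PX i true).real {true}) with ht₁
    set t₀ := prior false * (tandemLaw prior PX i false).real {false} /
        (prior true * (tandemLaw prior PX i true).real {false}) with ht₀
    have p₁ : 0 < t₁ := by have := ih' false true; have := ih' true true; positivity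
    have p₀ : 0 < t₀ := by have := ih' false false; have := ih' true false; positivity
    have q₁ := ih' j true
    have q₀ := ih' j false
    have g₁ := hG j t₁ p₁
    have g₀ := hG j t₀ p₀
    have f₁ := hF j t₁ p₁
    have f₀ := hF j t₀ p₀
    have a₁ := lrCDF_add_lrTail PX j t₁
    have a₀ := lrCDF_add_lrTail PX j t₀
    have s₁ := hsum (i + 1)
    have s₀ := hsum i
    have hpos : 0 < (tandemLaw prior PX (i + 1) j).real {true} := by rw [e]; positivity
    cases b
    · have : (tandemLaw prior PX (i + 1) j).real {false} =
          lrCDF PX j t₁ * (tandemLaw prior PX i j).real {true} +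
          lrCDF PX j t₀ * (tandemLaw prior PX i j).real {false} := by
        have e₁ : lrCDF PX j t₁ = 1 - lrTail PX j t₁ := by linarith
        have e₀ : lrCDF PX j t₀ = 1 - lrTail PX j t₀ := by linarith
        rw [e₁, e₀]
        linarith
      rw [this]
      positivity
    · exact hpos

/-- The error probability of the last node of a tandem network in which it has `i` predecessors. -/
noncomputable def tandemError (prior : Bool → ℝ) (PX : Bool → Measure S) (i : ℕ) : ℝ :=
  prior false * (tandemLaw prior PX i false).real {true} +
    prior true * (tandemLaw prior PX i true).real {false}

/-- With linear tails the error probability of a tandem network is of exact order `1 / n`. -/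
theorem exists_tandemError_bounds (hprior : ∀ j, 0 < prior j)
    (hsum : prior false + prior true = 1) (hPX₁₀ : PX true ≪ PX false)
    (hPX₀₁ : PX false ≪ PX true) (htails : HasLinearTails prior PX) :
    ∃ a A : ℝ, 0 < a ∧ 0 < A ∧ ∀ n : ℕ,
      a ≤ (n + 1) * tandemError prior PX n ∧ (n + 1) * tandemError prior PX n ≤ A := by
  have h0 := hprior false
  have h1 := hprior true
  obtain ⟨c, C, hc, hC, hF⟩ := exists_lrCDF_bounds PX hprior hsum hPX₁₀ htails
  obtain ⟨c', C', hc', hC', hG⟩ := exists_lrTail_bounds PX hprior hsum hPX₁₀ htails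
  have hF0 : ∀ t, 0 < t → 0 < lrCDF PX false t := fun t ht =>
    lt_of_lt_of_le (by positivity) (hF t ht).1
  have hG1 : ∀ t, 0 < t → 0 < lrTail PX true t := fun t ht =>
    lt_of_lt_of_le (by positivity) (hG t ht).1
  have hpos := tandemLaw_real_pos (PX := PX) hprior
    (fun j t ht => by
      cases j
      · exact hF0 t ht
      · exact lrCDF_false_pos_imp hPX₀₁ (hF0 t ht))
    (fun j t ht => by
      cases j
      · exact lrTail_true_pos_imp hPX₁₀ (hG1 t ht)
      · exact hG1 t ht)
  obtain ⟨k, K, hk, hK, hdec⟩ := exists_error_decrement_bounds (lrCDF PX) (lrTail PX) h0 h1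
    (by linarith) (by linarith) (lt_min hc hc') (lt_max_of_lt_left hC)
    (fun _ _ => measureReal_nonneg) (fun _ _ => measureReal_le_one)
    (fun _ _ => measureReal_nonneg) (fun _ _ => measureReal_le_one)
    (fun t ht => le_trans (by gcongr; exact min_le_left c c') (hF t ht).1)
    (fun t ht => (hF t ht).2.trans (by gcongr; exact le_max_left C C'))
    (fun t ht => le_trans (by gcongr; exact min_le_right c c') (hG t ht).1)
    (fun t ht => (hG t ht).2.trans (by gcongr; exact le_max_right C C'))
    (fun t ht => lrCDF_true_le PX hPX₁₀ ht)
    (fun t ht => mul_lrTail_false_le PX hPX₁₀ ht)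
  have hadd := fun i j => tandemLaw_real_false_add_true (prior := prior) (PX := PX) i j
  have hstep : ∀ n, k * tandemError prior PX n ^ 2 ≤
        tandemError prior PX n - tandemError prior PX (n + 1) ∧
      tandemError prior PX n - tandemError prior PX (n + 1) ≤ K * tandemError prior PX n ^ 2 := by
    intro n
    have e₁ : (tandemLaw prior PX n true).real {true} =
        1 - (tandemLaw prior PX n true).real {false} := by linarith [hadd n true]
    have e₀ : (tandemLaw prior PX n false).real {false} =
        1 - (tandemLaw prior PX n false).real {true} := by linarith [hadd n false]
    have r₀ := tandemLaw_succ_real_true hprior n (hpos n) false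
    have r₁ := tandemLaw_succ_real_true hprior n (hpos n) true
    rw [e₀, e₁] at r₀ r₁
    have p₀ := hpos n false false
    have p₁ := hpos n true true
    rw [e₀] at p₀
    rw [e₁] at p₁
    refine hdec _ _ _ _ _ _ (hpos n false true) (by linarith) (hpos n true false) (by linarith)
      rfl rfl ?_ ?_
    · rw [r₀]
      have := lrCDF_add_lrTail PX false (prior false * (tandemLaw prior PX n false).real {true} /
        (prior true * (1 - (tandemLaw prior PX n true).real {false})))
      rw [← eq_sub_iff_add_eq] at this
      rw [this]
      ring
    · have hs := hadd (n + 1) true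
      rw [r₁] at hs
      have := lrCDF_add_lrTail PX true (prior false * (tandemLaw prior PX n false).real {true} /
        (prior true * (1 - (tandemLaw prior PX n true).real {false})))
      rw [← eq_sub_iff_add_eq] at this
      rw [this]
      linarith
  refine exists_bounds_of_quadratic_decrement (tandemError prior PX) (fun n => ?_) (fun n => ?_)
    hk hK (fun n => (hstep n).1) (fun n => (hstep n).2)
  · have := hpos n false true
    have := hpos n true false
    unfold tandemError
    positivity
  · unfold tandemError
    have := mul_le_of_le_one_right h0.le
      (measureReal_le_one (μ := tandemLaw prior PX n false) (s := {true}))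
    have := mul_le_of_le_one_right h1.le
      (measureReal_le_one (μ := tandemLaw prior PX n true) (s := {false}))
    linarith

end

end ErasureNetwork

/-! ### Backward search: measurability and independence of the decision -/

namespace ErasureNetwork

variable {S : Type*} [MeasurableSpace S]

/-- The search is defined by peeling off its last step, `tandemDecision` by peeling off its first;
this reconciles the two recursions. -/
theorem backwardSearch_succ_eq_bind (er : ℕ → Bool) (n k i : ℕ) :
    backwardSearch er n k (i + 1) =
      (latestUnerased er n k).bind fun k' => backwardSearch er n k' i := by
  induction i with
  | zero => simp [backwardSearch]
  | succ i ih =>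
    rw [backwardSearch, ih, Option.bind_assoc]
    rfl

theorem latestUnerased_mem {er : ℕ → Bool} {n k k' : ℕ} (h : latestUnerased er n k = some k') :
    k' ∈ unerased er n k := by
  unfold latestUnerased at h
  split_ifs at h with hne
  rw [← Option.some_inj.1 h]
  exact Finset.max'_mem _ _

theorem latestUnerased_bounds {er : ℕ → Bool} {n k k' : ℕ}
    (h : latestUnerased er n k = some k') : k - n ≤ k' ∧ k' < k := by
  have := latestUnerased_mem h
  simpa [unerased] using (Finset.mem_filter.1 this).1

theorem exists_latestUnerased {er : ℕ → Bool} {n k i : ℕ} (hi : i ∈ Finset.Ico (k - n) k)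
    (her : er i = false) : ∃ k', latestUnerased er n k = some k' := by
  have : (unerased er n k).Nonempty := ⟨i, Finset.mem_filter.2 ⟨hi, her⟩⟩
  exact ⟨_, dif_pos this⟩

/-- The nodes met by the search are random but take countably many values, so events are split
according to them. -/
theorem measurableSet_mem_of_countable_fibers {α ι : Type*} [MeasurableSpace α] [Countable ι]
    {g : α → ι} (hg : ∀ o, MeasurableSet {a | g a = o}) {A : ι → Set α}
    (hA : ∀ o, MeasurableSet (A o)) : MeasurableSet {a | a ∈ A (g a)} := by
  have : {a | a ∈ A (g a)} = ⋃ o, {a | g a = o} ∩ A o := by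
    ext a
    simp
  rw [this]
  exact MeasurableSet.iUnion fun o => (hg o).inter (hA o)

theorem measurableSet_latestUnerased (n k : ℕ) (o : Option ℕ) :
    MeasurableSet {er : ℕ → Bool | latestUnerased er n k = o} := by
  have hun : ∀ s : Finset ℕ, MeasurableSet {er : ℕ → Bool | unerased er n k = s} := fun s => by
    have : {er : ℕ → Bool | unerased er n k = s} =
        ⋂ i, {er | (i ∈ Finset.Ico (k - n) k ∧ er i = false) ↔ i ∈ s} := by
      ext er
      simp [unerased, Finset.ext_iff]
    rw [this]
    refine MeasurableSet.iInter fun i => ?_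
    have hpre : {er : ℕ → Bool | (i ∈ Finset.Ico (k - n) k ∧ er i = false) ↔ i ∈ s} =
        (fun er : ℕ → Bool => er i) ⁻¹'
          {b | (i ∈ Finset.Ico (k - n) k ∧ b = false) ↔ i ∈ s} := rfl
    rw [hpre]
    exact measurable_pi_apply i (Set.toFinite _).measurableSet
  classical
  exact measurableSet_mem_of_countable_fibers hun
    (A := fun s => {_er | (if h : s.Nonempty then some (s.max' h) else none) = o})
    fun s => MeasurableSet.const _

theorem measurableSet_backwardSearch (n k i : ℕ) (o : Option ℕ) :
    MeasurableSet {er : ℕ → Bool | backwardSearch er n k i = o} := by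
  induction i generalizing o with
  | zero => exact MeasurableSet.const (some k = o)
  | succ i ih =>
    refine measurableSet_mem_of_countable_fibers ih
      (A := fun o' => {er | o'.bind (latestUnerased er n) = o}) fun o' => ?_
    cases o' with
    | none => exact MeasurableSet.const (none = o)
    | some k' => exact measurableSet_latestUnerased n k' o

theorem measurableSet_hasTandem (n k : ℕ) : MeasurableSet {er : ℕ → Bool | HasTandem er n k} :=
  measurableSet_mem_of_countable_fibers (measurableSet_backwardSearch n k n)
    (A := fun o => {_er | o.isSome}) fun _ => MeasurableSet.const _

theorem measurable_tandemDecision (prior : Bool → ℝ) (PX : Bool → Measure S) (n i k : ℕ) :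
    Measurable fun p : (ℕ → S) × (ℕ → Bool) => tandemDecision prior PX p.1 p.2 n i k := by
  have hpriv : ∀ k, Measurable fun p : (ℕ → S) × (ℕ → Bool) => privateTest prior PX (p.1 k) :=
    fun k => (measurable_privateTest prior PX).comp ((measurable_pi_apply k).comp measurable_fst)
  induction i generalizing k with
  | zero => exact hpriv k
  | succ i ih =>
    refine measurable_to_bool ?_
    refine measurableSet_mem_of_countable_fibers
      (g := fun p : (ℕ → S) × (ℕ → Bool) => latestUnerased p.2 n k)
      (fun o => measurable_snd (measurableSet_latestUnerased n k o))
      (A := fun o => (fun p => match o with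
        | some k' => relayTest prior PX (tandemLaw prior PX i) (p.1 k)
          (tandemDecision prior PX p.1 p.2 n i k')
        | none => privateTest prior PX (p.1 k)) ⁻¹' {true}) fun o => ?_
    cases o with
    | none => exact hpriv k (measurableSet_singleton _)
    | some k' =>
      exact (measurable_relayTest prior PX (tandemLaw prior PX i)).comp
        (((measurable_pi_apply k).comp measurable_fst).prodMk (ih k')) (measurableSet_singleton _)

variable {Ω : Type*}

/-- For a fixed erasure pattern, a tandem decision of `a_k` uses only the signals of
`a_0, …, a_k`. -/
theorem measurable_tandemDecision_iSup_comap (prior : Bool → ℝ) (PX : Bool → Measure S)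
    (X : ℕ → Ω → S) (er : ℕ → Bool) (n i k : ℕ) :
    Measurable[⨆ l ∈ Set.Iic k, MeasurableSpace.comap (X l) inferInstance]
      fun ω => tandemDecision prior PX (fun l => X l ω) er n i k := by
  have hX : ∀ k, Measurable[⨆ l ∈ Set.Iic k, MeasurableSpace.comap (X l) inferInstance] (X k) :=
    fun k => Measurable.mono (comap_measurable (X k))
      (le_iSup₂_of_le (f := fun l (_ : l ∈ Set.Iic k) =>
        MeasurableSpace.comap (X l) inferInstance) k (Set.mem_Iic.2 le_rfl) le_rfl) le_rfl
  induction i generalizing k with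
  | zero => exact (measurable_privateTest prior PX).comp (hX k)
  | succ i ih =>
    simp only [tandemDecision]
    cases h : latestUnerased er n k with
    | none => exact (measurable_privateTest prior PX).comp (hX k)
    | some k' =>
      refine (measurable_relayTest prior PX (tandemLaw prior PX i)).comp
        (Measurable.prodMk (hX k) ?_)
      exact Measurable.mono (ih k') (biSup_mono fun l hl =>
        Set.mem_Iic.2 ((Set.mem_Iic.1 hl).trans (latestUnerased_bounds h).2.le)) le_rfl

section Model
variable [MeasurableSpace Ω] {prior : Bool → ℝ} {PX : Bool → Measure S}
  {P : Bool → Measure Ω} [∀ j, IsProbabilityMeasure (P j)]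
  {q : ℕ → ℝ} {X : ℕ → Ω → S} {Z : ℕ → Ω → Bool}

/-- With the erasures frozen, the decision of the predecessor depends on signals of index at most
`k' < k`, hence is independent of `X k`, which reproduces the recursion of `tandemLaw`. Each step
moves back by at most `n`, so `i * n < k` keeps the search off the index `0`, whose signal law is
unspecified. -/
theorem IsModel.map_tandemDecision (hmodel : IsModel P PX q X Z) (j : Bool) {er : ℕ → Bool}
    {n i k : ℕ} (h : (backwardSearch er n k i).isSome) (hk : i * n < k) :
    (P j).map (fun ω => tandemDecision prior PX (fun l => X l ω) er n i k) =
      tandemLaw prior PX i j := by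
  induction i generalizing k with
  | zero =>
    change (P j).map (privateTest prior PX ∘ X k) = (PX j).map (privateTest prior PX)
    rw [← Measure.map_map (measurable_privateTest prior PX) (hmodel.measurable_signal k),
      hmodel.signal_law j k (by omega)]
  | succ i ih =>
    rw [backwardSearch_succ_eq_bind] at h
    cases hl : latestUnerased er n k with
    | none => simp [hl] at h
    | some k' =>
      obtain ⟨hb₁, hb₂⟩ := latestUnerased_bounds hl
      rw [hl] at h
      have hk' : i * n < k' := by rw [Nat.succ_mul] at hk; omega
      have hlaw := ih (k := k') h hk'
      have hle : ∀ l, MeasurableSpace.comap (X l) inferInstance ≤ (inferInstance : MeasurableSpace Ω) :=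
        fun l => (hmodel.measurable_signal l).comap_le
      have hDmeas := measurable_tandemDecision_iSup_comap prior PX X er n i k'
      have hind : IndepFun (X k)
          (fun ω => tandemDecision prior PX (fun l => X l ω) er n i k') (P j) := by
        rw [IndepFun_iff_Indep]
        have := indep_iSup_of_disjoint hle (hmodel.indep_signal j).iIndep
          (S := {k}) (T := Set.Iic k') (by simpa using hb₂)
        rw [iSup_singleton] at this
        exact indep_of_indep_of_le_right this hDmeas.comap_le
      have hD : Measurable fun ω => tandemDecision prior PX (fun l => X l ω) er n i k' :=
        hDmeas.mono (iSup₂_le fun l _ => hle l) le_rfl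
      have hpair := (indepFun_iff_map_prod_eq_prod_map_map
        (hmodel.measurable_signal k).aemeasurable hD.aemeasurable).1 hind
      rw [hmodel.signal_law j k (by omega), hlaw] at hpair
      simp only [tandemDecision, hl]
      change _ = ((PX j).prod (tandemLaw prior PX i j)).map _
      rw [← hpair, Measure.map_map (measurable_relayTest prior PX _)
        ((hmodel.measurable_signal k).prodMk hD)]
      rfl

/-- The tandem decision is independent of the event that a tandem network is found. -/
theorem IsModel.real_hasTandem_inter (hmodel : IsModel P PX q X Z) (j b : Bool) {n k : ℕ}
    (hk : n ^ 2 < k) :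
    (P j).real {ω | HasTandem (fun i => Z i ω) n k ∧
        tandemDecision prior PX (fun i => X i ω) (fun i => Z i ω) n n k = b} =
      (P j).real {ω | HasTandem (fun i => Z i ω) n k} * (tandemLaw prior PX n j).real {b} := by
  have hX : Measurable fun ω k => X k ω := measurable_pi_lambda _ hmodel.measurable_signal
  have hZ : Measurable fun ω k => Z k ω := measurable_pi_lambda _ hmodel.measurable_erasure
  have hpair := (indepFun_iff_map_prod_eq_prod_map_map hX.aemeasurable hZ.aemeasurable).1
    (hmodel.indep_signal_erasure j)
  have hH := measurableSet_hasTandem n k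
  have hD := measurable_tandemDecision prior PX n n k
  set B : Set ((ℕ → S) × (ℕ → Bool)) :=
    {p | HasTandem p.2 n k ∧ tandemDecision prior PX p.1 p.2 n n k = b} with hB
  have hBm : MeasurableSet B := (measurable_snd hH).inter (hD (measurableSet_singleton b))
  have key : P j {ω | HasTandem (fun i => Z i ω) n k ∧
        tandemDecision prior PX (fun i => X i ω) (fun i => Z i ω) n n k = b} =
      tandemLaw prior PX n j {b} * P j {ω | HasTandem (fun i => Z i ω) n k} := by
    have e : P j {ω | HasTandem (fun i => Z i ω) n k ∧
        tandemDecision prior PX (fun i => X i ω) (fun i => Z i ω) n n k = b} =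
        (P j).map (fun ω => ((fun k => X k ω), fun k => Z k ω)) B := by
      rw [Measure.map_apply (hX.prodMk hZ) hBm]
      rfl
    have e' : P j {ω | HasTandem (fun i => Z i ω) n k} =
        (P j).map (fun ω k => Z k ω) {er | HasTandem er n k} := by
      rw [Measure.map_apply hZ hH]
      rfl
    have : IsProbabilityMeasure ((P j).map fun ω k => X k ω) :=
      Measure.isProbabilityMeasure_map hX.aemeasurable
    have : IsProbabilityMeasure ((P j).map fun ω k => Z k ω) :=
      Measure.isProbabilityMeasure_map hZ.aemeasurable
    -- Integrate over the erasure pattern last: the section of `B` at `z` has the same probability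
    -- for every `z` containing a tandem, and is empty otherwise.
    rw [e, e', hpair, Measure.prod_apply_symm hBm, ← lintegral_indicator_const hH]
    refine lintegral_congr fun z => ?_
    by_cases hz : HasTandem z n k
    · rw [Set.indicator_of_mem (show z ∈ {er | HasTandem er n k} from hz),
        ← hmodel.map_tandemDecision (prior := prior) j hz (by rwa [← sq])]
      have hDz : Measurable fun ω => tandemDecision prior PX (fun l => X l ω) z n n k :=
        (hD.comp measurable_prodMk_right).comp hX
      rw [Measure.map_apply hX (measurable_prodMk_right hBm),
        Measure.map_apply hDz (measurableSet_singleton b)]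
      congr 1
      ext ω
      simp [hB, hz]
    · rw [Set.indicator_of_notMem (show z ∉ {er | HasTandem er n k} from hz)]
      have : (fun x => (x, z)) ⁻¹' B = ∅ := by
        ext x
        simp [hB, hz]
      rw [this, measure_empty]
  rw [measureReal_def, key, ENNReal.toReal_mul, mul_comm]
  rfl

end Model

end ErasureNetwork

/-! ### Success probability of the search, and the error of `a_k` -/

namespace ErasureNetwork

theorem hasTandem_of_forall_unerased {er : ℕ → Bool} {n k : ℕ} (hnk : n < k)
    (h : ∀ i ∈ Finset.Ico (k - n) k, er i = false) : HasTandem er n k := by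
  have key : ∀ i, i ≤ n → backwardSearch er n k i = some (k - i) := fun i => by
    induction i with
    | zero => exact fun _ => rfl
    | succ i ih =>
      intro hi
      rw [backwardSearch, ih (by omega), Option.bind_some]
      obtain ⟨k', hk'⟩ := exists_latestUnerased (n := n) (k := k - i) (i := k - (i + 1))
        (Finset.mem_Ico.2 ⟨by omega, by omega⟩) (h _ (Finset.mem_Ico.2 ⟨by omega, by omega⟩))
      have hb := (latestUnerased_bounds hk').2
      have hmem : k - (i + 1) ∈ unerased er n (k - i) :=
        Finset.mem_filter.2 ⟨Finset.mem_Ico.2 ⟨by omega, by omega⟩,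
          h _ (Finset.mem_Ico.2 ⟨by omega, by omega⟩)⟩
      have hle : k - (i + 1) ≤ k' := by
        unfold latestUnerased at hk'
        rw [dif_pos ⟨_, hmem⟩] at hk'
        rw [← Option.some_inj.1 hk']
        exact Finset.le_max' _ _ hmem
      rw [hk']
      congr 1
      omega
  simp [HasTandem, key n le_rfl]

/-- After `i < n` steps the search is at some `k' ≥ k - i * n ≥ k - n ^ 2 + n`, so only windows
ending at such nodes matter, and these stay above `k - n ^ 2`. -/
theorem hasTandem_of_forall_exists_unerased {er : ℕ → Bool} {n k : ℕ} (hnk : n ^ 2 < k)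
    (h : ∀ l ∈ Finset.Icc (k - n ^ 2 + n) k, ∃ i ∈ Finset.Ico (l - n) l, er i = false) :
    HasTandem er n k := by
  have key : ∀ i, i ≤ n → ∃ k', backwardSearch er n k i = some k' ∧ k' ≤ k ∧ k ≤ k' + i * n := by
    intro i
    induction i with
    | zero => exact fun _ => ⟨k, rfl, le_rfl, by simp⟩
    | succ i ih =>
      intro hi
      obtain ⟨k', hk', hle, hge⟩ := ih (by omega)
      have hin : i * n + n ≤ n ^ 2 := by nlinarith
      obtain ⟨l, hl, hel⟩ := h k' (Finset.mem_Icc.2 ⟨by omega, hle⟩)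
      obtain ⟨k'', hk''⟩ := exists_latestUnerased hl hel
      have hb := latestUnerased_bounds hk''
      refine ⟨k'', by rw [backwardSearch, hk', Option.bind_some, hk''], by omega, ?_⟩
      rw [Nat.succ_mul]
      omega
  obtain ⟨k', hk', -⟩ := key n le_rfl
  simp [HasTandem, hk']

variable {S : Type*} [MeasurableSpace S] {Ω : Type*} [MeasurableSpace Ω]
  {PX : Bool → Measure S} {P : Bool → Measure Ω}
  {q : ℕ → ℝ} {X : ℕ → Ω → S} {Z : ℕ → Ω → Bool}

theorem IsModel.real_forall_eq (hmodel : IsModel P PX q X Z) (j b : Bool) (s : Finset ℕ) :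
    (P j).real {ω | ∀ i ∈ s, Z i ω = b} = ∏ i ∈ s, (P j).real {ω | Z i ω = b} := by
  have h := (hmodel.indep_erasure j).measure_inter_preimage_eq_mul s (sets := fun _ => {b})
    fun _ _ => measurableSet_singleton b
  have e : {ω | ∀ i ∈ s, Z i ω = b} = ⋂ i ∈ s, Z i ⁻¹' {b} := by
    ext ω
    simp
  rw [measureReal_def, e, h, ENNReal.toReal_prod]
  rfl

theorem IsModel.measurableSet_hasTandem (hmodel : IsModel P PX q X Z) (n k : ℕ) :
    MeasurableSet {ω | HasTandem (fun i => Z i ω) n k} :=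
  measurable_pi_lambda _ hmodel.measurable_erasure (ErasureNetwork.measurableSet_hasTandem n k)

variable [∀ j, IsProbabilityMeasure (P j)]

theorem IsModel.real_unerased (hmodel : IsModel P PX q X Z) (j : Bool) {k : ℕ} (hk : 1 ≤ k) :
    (P j).real {ω | Z k ω = false} = 1 - q k := by
  have h := probReal_compl_eq_one_sub (μ := P j)
    (hmodel.measurable_erasure k (measurableSet_singleton true))
  rw [← hmodel.erasure_prob j k hk]
  have e : (Z k ⁻¹' {true})ᶜ = {ω | Z k ω = false} := by
    ext ω
    simp
  rwa [e] at h

/-- A crude bound, for small `n` only: with no erasure among the last `n` broadcasts, the search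
steps back one node at a time. -/
theorem IsModel.pow_le_real_hasTandem (hmodel : IsModel P PX q X Z) {ε : ℝ} (hε : 0 < ε)
    (hq : ∀ k, 1 ≤ k → q k ≤ 1 - ε) (j : Bool) {n k : ℕ} (hnk : n ^ 2 < k) :
    ε ^ n ≤ (P j).real {ω | HasTandem (fun i => Z i ω) n k} := by
  have hnk' : n < k := lt_of_le_of_lt (Nat.le_self_pow two_ne_zero n) hnk
  calc ε ^ n = ∏ _i ∈ Finset.Ico (k - n) k, ε := by
        rw [Finset.prod_const, Nat.card_Ico]; congr 1; omega
    _ ≤ ∏ i ∈ Finset.Ico (k - n) k, (P j).real {ω | Z i ω = false} := by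
        refine Finset.prod_le_prod (fun _ _ => hε.le) fun i hi => ?_
        have hi1 : 1 ≤ i := by have := (Finset.mem_Ico.1 hi).1; omega
        rw [hmodel.real_unerased j hi1]
        linarith [hq i hi1]
    _ = (P j).real {ω | ∀ i ∈ Finset.Ico (k - n) k, Z i ω = false} :=
        (hmodel.real_forall_eq j false _).symm
    _ ≤ _ := measureReal_mono fun ω hω => hasTandem_of_forall_unerased hnk' hω

theorem IsModel.real_not_hasTandem_le (hmodel : IsModel P PX q X Z) {ε : ℝ}
    (hq : ∀ k, 1 ≤ k → q k ≤ 1 - ε) (j : Bool) {n k : ℕ} (hnk : n ^ 2 < k) :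
    (P j).real {ω | ¬ HasTandem (fun i => Z i ω) n k} ≤ (n ^ 2 + 1) * (1 - ε) ^ n := by
  -- That `ε ≤ 1` is forced, since `q 1` is a probability.
  have hr : 0 ≤ 1 - ε := by
    have := hmodel.erasure_prob j 1 le_rfl
    linarith [hq 1 le_rfl, measureReal_nonneg (μ := P j) (s := {ω | Z 1 ω = true})]
  have hn : n ≤ n ^ 2 := Nat.le_self_pow two_ne_zero n
  calc (P j).real {ω | ¬ HasTandem (fun i => Z i ω) n k}
      ≤ (P j).real (⋃ l ∈ Finset.Icc (k - n ^ 2 + n) k,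
          {ω | ∀ i ∈ Finset.Ico (l - n) l, Z i ω = true}) := by
        refine measureReal_mono (fun ω hω => ?_) (measure_ne_top _ _)
        by_contra hcon
        refine hω (hasTandem_of_forall_exists_unerased hnk fun l hl => ?_)
        by_contra! hall
        refine hcon (Set.mem_biUnion hl fun i hi => ?_)
        simpa using hall i hi
    _ ≤ ∑ l ∈ Finset.Icc (k - n ^ 2 + n) k,
          (P j).real {ω | ∀ i ∈ Finset.Ico (l - n) l, Z i ω = true} :=
        measureReal_biUnion_finset_le _ _
    _ ≤ ∑ _l ∈ Finset.Icc (k - n ^ 2 + n) k, (1 - ε) ^ n := by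
        refine Finset.sum_le_sum fun l hl => ?_
        have hl1 := (Finset.mem_Icc.1 hl).1
        rw [hmodel.real_forall_eq]
        calc _ ≤ ∏ _i ∈ Finset.Ico (l - n) l, (1 - ε) := by
              refine Finset.prod_le_prod (fun _ _ => measureReal_nonneg) fun i hi => ?_
              have hi1 : 1 ≤ i := by have := (Finset.mem_Ico.1 hi).1; omega
              rw [hmodel.erasure_prob j i hi1]
              exact hq i hi1
          _ = (1 - ε) ^ n := by
              rw [Finset.prod_const, Nat.card_Ico]; congr 1; omega
    _ ≤ (n ^ 2 + 1) * (1 - ε) ^ n := by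
        rw [Finset.sum_const, Nat.card_Icc, nsmul_eq_mul]
        gcongr
        have : k + 1 - (k - n ^ 2 + n) ≤ n ^ 2 + 1 := by omega
        exact_mod_cast this

/-- The backward search succeeds with probability bounded away from `0`, and the probability that
it fails is `O(1 / n)`, uniformly in the starting node. -/
theorem IsModel.exists_hasTandem_bounds (hmodel : IsModel P PX q X Z) {ε : ℝ} (hε : 0 < ε)
    (hq : ∀ k, 1 ≤ k → q k ≤ 1 - ε) :
    ∃ p M : ℝ, 0 < p ∧ 0 < M ∧ ∀ (j : Bool) (n k : ℕ), n ^ 2 < k →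
      p ≤ (P j).real {ω | HasTandem (fun i => Z i ω) n k} ∧
      (n + 1) * (P j).real {ω | ¬ HasTandem (fun i => Z i ω) n k} ≤ M := by
  have hr : 0 ≤ 1 - ε := by
    have := hmodel.erasure_prob false 1 le_rfl
    linarith [hq 1 le_rfl, measureReal_nonneg (μ := P false) (s := {ω | Z 1 ω = true})]
  have habs : |1 - ε| < 1 := by rw [abs_of_nonneg hr]; linarith
  set f : ℕ → ℝ := fun n => (n + 1) * ((n ^ 2 + 1) * (1 - ε) ^ n) with hf
  have hlim : Tendsto f atTop (𝓝 0) := by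
    have h := fun m => tendsto_pow_const_mul_const_pow_of_abs_lt_one m habs
    have := (((h 3).add (h 2)).add (h 1)).add (h 0)
    simp only [add_zero] at this
    refine this.congr fun n => ?_
    simp only [hf]
    ring
  -- Beyond `N` failure has probability below `1 / 2`; up to `N` the bound `ε ^ n ≥ ε ^ N` serves.
  -- Small `n` cannot be discarded, because the tandem length stays bounded when `σ = 0`.
  obtain ⟨M, hM⟩ := hlim.bddAbove_range
  obtain ⟨N, hN⟩ := eventually_atTop.1 (hlim.eventually_lt_const (by norm_num : (0 : ℝ) < 1 / 2))
  refine ⟨min (ε ^ N) (1 / 2), max M 1, by positivity, by positivity, fun j n k hnk => ⟨?_, ?_⟩⟩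
  · rcases le_total N n with h | h
    · refine (min_le_right _ _).trans ?_
      have h1 := hmodel.real_not_hasTandem_le hq j hnk
      have h2 := hN n h
      have h3 : (n ^ 2 + 1) * (1 - ε) ^ n ≤ f n :=
        le_mul_of_one_le_left (by positivity) (by linarith [n.cast_nonneg (α := ℝ)])
      have h4 := probReal_add_probReal_compl (μ := P j) (hmodel.measurableSet_hasTandem n k)
      change _ + (P j).real {ω | ¬ HasTandem (fun i => Z i ω) n k} = 1 at h4
      linarith
    · exact (min_le_left _ _).trans ((pow_le_pow_of_le_one hε.le (by linarith) h).trans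
        (hmodel.pow_le_real_hasTandem hε hq j hnk))
  · calc (n + 1) * (P j).real {ω | ¬ HasTandem (fun i => Z i ω) n k}
        ≤ (n + 1) * ((n ^ 2 + 1) * (1 - ε) ^ n) := by
          gcongr; exact hmodel.real_not_hasTandem_le hq j hnk
      _ ≤ M := hM ⟨n, rfl⟩
      _ ≤ max M 1 := le_max_left _ _

/-- The error probability of `a_k` is of the order of `1 / (n + 1)`, where `n` is the length of the
tandem networks that it looks for. -/
theorem IsModel.exists_errorProb_bounds {prior : Bool → ℝ} (hprior : ∀ j, 0 < prior j)
    (hsum : prior false + prior true = 1) [∀ j, IsProbabilityMeasure (PX j)]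
    (hPX₁₀ : PX true ≪ PX false) (hPX₀₁ : PX false ≪ PX true) (htails : HasLinearTails prior PX)
    (hmodel : IsModel P PX q X Z) {ε : ℝ} (hε : 0 < ε) (hq : ∀ k, 1 ≤ k → q k ≤ 1 - ε) :
    ∃ a A : ℝ, 0 < a ∧ 0 < A ∧ ∀ (n k : ℕ) (d : Ω → Bool), n ^ 2 < k →
      (∀ ω, HasTandem (fun i => Z i ω) n k →
        d ω = tandemDecision prior PX (fun i => X i ω) (fun i => Z i ω) n n k) →
      a ≤ (n + 1) * errorProb prior P d ∧ (n + 1) * errorProb prior P d ≤ A := by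
  obtain ⟨a, A, ha, hA, he⟩ := exists_tandemError_bounds hprior hsum hPX₁₀ hPX₀₁ htails
  obtain ⟨p, M, hp, hM, hH⟩ := hmodel.exists_hasTandem_bounds hε hq
  refine ⟨p * a, A + M, by positivity, by positivity, fun n k d hnk hd => ?_⟩
  have h0 := hprior false
  have h1 := hprior true
  have hlow : ∀ j b, p * (tandemLaw prior PX n j).real {b} ≤ (P j).real {ω | d ω = b} := by
    intro j b
    calc p * (tandemLaw prior PX n j).real {b}
        ≤ (P j).real {ω | HasTandem (fun i => Z i ω) n k} * (tandemLaw prior PX n j).real {b} := by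
          gcongr; exact (hH j n k hnk).1
      _ = _ := (hmodel.real_hasTandem_inter j b hnk).symm
      _ ≤ _ := measureReal_mono fun ω hω => (hd ω hω.1).trans hω.2
  have hup : ∀ j b, (P j).real {ω | d ω = b} ≤ (tandemLaw prior PX n j).real {b} +
      (P j).real {ω | ¬ HasTandem (fun i => Z i ω) n k} := by
    intro j b
    calc (P j).real {ω | d ω = b}
        ≤ (P j).real ({ω | HasTandem (fun i => Z i ω) n k ∧
            tandemDecision prior PX (fun i => X i ω) (fun i => Z i ω) n n k = b} ∪
            {ω | ¬ HasTandem (fun i => Z i ω) n k}) := by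
          refine measureReal_mono fun ω hω => ?_
          by_cases h : HasTandem (fun i => Z i ω) n k
          · exact Or.inl ⟨h, (hd ω h).symm.trans hω⟩
          · exact Or.inr h
      _ ≤ _ := measureReal_union_le _ _
      _ ≤ _ := by
          gcongr
          rw [hmodel.real_hasTandem_inter j b hnk]
          exact mul_le_of_le_one_left measureReal_nonneg measureReal_le_one
  have hn : (0 : ℝ) < n + 1 := by positivity
  constructor
  · calc p * a ≤ p * ((n + 1) * tandemError prior PX n) := by gcongr; exact (he n).1
      _ = (n + 1) * (prior false * (p * (tandemLaw prior PX n false).real {true}) +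
          prior true * (p * (tandemLaw prior PX n true).real {false})) := by
        unfold tandemError; ring
      _ ≤ (n + 1) * errorProb prior P d := by
        unfold errorProb
        gcongr
        · exact hlow false true
        · exact hlow true false
  · calc (n + 1) * errorProb prior P d
        ≤ (n + 1) * (prior false * ((tandemLaw prior PX n false).real {true} +
            (P false).real {ω | ¬ HasTandem (fun i => Z i ω) n k}) +
          prior true * ((tandemLaw prior PX n true).real {false} +
            (P true).real {ω | ¬ HasTandem (fun i => Z i ω) n k})) := by
          unfold errorProb
          gcongr
          · exact hup false true
          · exact hup true false
      _ = (n + 1) * tandemError prior PX n +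
          (prior false * ((n + 1) * (P false).real {ω | ¬ HasTandem (fun i => Z i ω) n k}) +
          prior true * ((n + 1) * (P true).real {ω | ¬ HasTandem (fun i => Z i ω) n k})) := by
          unfold tandemError; ring
      _ ≤ A + (prior false * M + prior true * M) := by
          gcongr
          · exact (he n).2
          · exact (hH false n k hnk).2
          · exact (hH true n k hnk).2
      _ = A + M := by rw [← add_mul, hsum, one_mul]

end ErasureNetwork

/-! ### Growth of the tandem length -/

namespace ErasureNetwork

theorem exists_rpow_bounds_of_isTheta {m : ℕ → ℕ} {σ : ℝ}
    (hmσ : (fun k : ℕ => (m k : ℝ)) =Θ[atTop] fun k : ℕ => (k : ℝ) ^ σ) :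
    ∃ c C : ℝ, 0 < c ∧ 0 < C ∧ ∀ᶠ k : ℕ in atTop,
      c * (k : ℝ) ^ σ ≤ m k ∧ (m k : ℝ) ≤ C * (k : ℝ) ^ σ := by
  obtain ⟨C, hC, hCm⟩ := hmσ.1.exists_pos
  obtain ⟨K, hK, hKm⟩ := hmσ.2.exists_pos
  refine ⟨K⁻¹, C, by positivity, hC, ?_⟩
  filter_upwards [hCm.bound, hKm.bound] with k h1 h2
  rw [Real.norm_of_nonneg (by positivity), Real.norm_of_nonneg (by positivity)] at h1 h2
  exact ⟨by rwa [inv_mul_le_iff₀ hK], h1⟩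

/-- A sequence of natural numbers of exact order `k ^ σ` has `0 ≤ σ`. -/
theorem nonneg_of_natCast_isTheta_rpow {m : ℕ → ℕ} {σ : ℝ}
    (hmσ : (fun k : ℕ => (m k : ℝ)) =Θ[atTop] fun k : ℕ => (k : ℝ) ^ σ) : 0 ≤ σ := by
  obtain ⟨c, C, hc, hC, h⟩ := exists_rpow_bounds_of_isTheta hmσ
  by_contra! hσ
  have hlim : Tendsto (fun k : ℕ => C * (k : ℝ) ^ σ) atTop (𝓝 0) := by
    have := ((tendsto_rpow_neg_atTop (neg_pos.2 hσ)).comp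
      tendsto_natCast_atTop_atTop).const_mul C
    simpa using this
  obtain ⟨k, ⟨h1, h2⟩, h3, hk⟩ :=
    (h.and ((hlim.eventually_lt_const one_pos).and (eventually_ge_atTop 1))).exists
  have hm : m k = 0 := by
    have : (m k : ℝ) < 1 := h2.trans_lt h3
    exact Nat.lt_one_iff.1 (by exact_mod_cast this)
  have : (0 : ℝ) < k := by exact_mod_cast hk
  have : 0 < c * (k : ℝ) ^ σ := by positivity
  rw [hm, Nat.cast_zero] at h1
  linarith

theorem exists_tandemLength_bounds {m : ℕ → ℕ} {σ s : ℝ}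
    (hmσ : (fun k : ℕ => (m k : ℝ)) =Θ[atTop] fun k : ℕ => (k : ℝ) ^ σ)
    (hs : s = min σ (1 / 2)) :
    ∃ c C : ℝ, 0 < c ∧ 0 < C ∧ ∀ᶠ k : ℕ in atTop,
      c * (k : ℝ) ^ s ≤ tandemLength m k + 1 ∧ (tandemLength m k + 1 : ℝ) ≤ C * (k : ℝ) ^ s := by
  have hσ := nonneg_of_natCast_isTheta_rpow hmσ
  obtain ⟨c, C, hc, hC, h⟩ := exists_rpow_bounds_of_isTheta hmσ
  have hs0 : 0 ≤ s := by rw [hs]; positivity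
  have hsσ : s ≤ σ := by rw [hs]; exact min_le_left _ _
  have hs2 : s ≤ 1 / 2 := by rw [hs]; exact min_le_right _ _
  obtain ⟨N, hN⟩ := eventually_atTop.1 h
  -- The bound `1 / 2` makes `n² ≤ k / 4`, so every node from `k - n²` on has index at least `k /
  -- 2`; the factor `(1 / 2) ^ σ` absorbs the smaller memory at such indices. Taking `k ≥ 2 * N`
  -- puts them all in the asymptotic range.
  set c' := min (c * (1 / 2 : ℝ) ^ σ) (1 / 2) with hc'
  have hc'0 : 0 < c' := by positivity
  refine ⟨c', max C 1 + 1, hc'0, by positivity, ?_⟩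
  filter_upwards [eventually_ge_atTop (2 * N), eventually_ge_atTop 1] with k hkN hk1
  have hk : (1 : ℝ) ≤ k := by exact_mod_cast hk1
  have hk0 : (0 : ℝ) < k := by linarith
  have hgr := tandemLength_isGreatest m k hk1
  have hsqrt : ((k : ℝ) ^ (1 / 2 : ℝ)) ^ 2 = k := by
    rw [← Real.rpow_natCast, ← Real.rpow_mul hk0.le]; norm_num
  constructor
  · set n := ⌊c' * (k : ℝ) ^ s⌋₊ with hn
    have hnle : (n : ℝ) ≤ c' * (k : ℝ) ^ s := Nat.floor_le (by positivity)
    have hn2 : (n : ℝ) ^ 2 ≤ k / 4 := by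
      calc (n : ℝ) ^ 2 ≤ (1 / 2 * (k : ℝ) ^ (1 / 2 : ℝ)) ^ 2 := by
            gcongr
            refine hnle.trans ?_
            gcongr
            exact min_le_right _ _
        _ = (k : ℝ) / 4 := by rw [mul_pow, hsqrt]; ring
    have hn2' : 4 * n ^ 2 ≤ k := by
      have : (4 : ℝ) * (n : ℝ) ^ 2 ≤ k := by linarith
      exact_mod_cast this
    have hmem : n ∈ {n | n ^ 2 < k ∧ ∀ i, k - n ^ 2 ≤ i → i ≤ k → n ≤ m i} := by
      refine ⟨by omega, fun i hi _ => ?_⟩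
      have hi2 : k ≤ 2 * i := by omega
      have hi2' : (1 / 2 : ℝ) * k ≤ i := by
        have : (k : ℝ) ≤ 2 * i := by exact_mod_cast hi2
        linarith
      have : (n : ℝ) ≤ m i := by
        calc (n : ℝ) ≤ c' * (k : ℝ) ^ s := hnle
          _ ≤ c * (1 / 2 : ℝ) ^ σ * (k : ℝ) ^ σ := by
              gcongr
              exact min_le_left _ _
          _ = c * ((1 / 2 : ℝ) * k) ^ σ := by
              rw [Real.mul_rpow (by norm_num) hk0.le, mul_assoc]
          _ ≤ c * (i : ℝ) ^ σ := by gcongr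
          _ ≤ m i := (hN i (by omega)).1
      exact_mod_cast this
    have hle : (n : ℝ) ≤ tandemLength m k := by exact_mod_cast hgr.2 hmem
    have := Nat.lt_floor_add_one (c' * (k : ℝ) ^ s)
    rw [← hn] at this
    linarith
  -- Only the memory of `a_k` itself and `n² < k` are needed for the upper bound.
  · obtain ⟨hsq, hmem⟩ := hgr.1
    have h1 : (tandemLength m k : ℝ) ≤ C * (k : ℝ) ^ σ := by
      have : (tandemLength m k : ℝ) ≤ m k := by exact_mod_cast hmem k (Nat.sub_le _ _) le_rfl
      exact this.trans (hN k (by omega)).2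
    have h2 : (tandemLength m k : ℝ) ≤ (k : ℝ) ^ (1 / 2 : ℝ) := by
      refine le_of_sq_le_sq ?_ (by positivity)
      rw [hsqrt]
      exact_mod_cast hsq.le
    have h3 : (tandemLength m k : ℝ) ≤ max C 1 * (k : ℝ) ^ s := by
      rcases min_choice σ (1 / 2) with h | h <;> rw [h] at hs <;> rw [hs]
      · exact h1.trans (by gcongr; exact le_max_left _ _)
      · exact h2.trans (le_mul_of_one_le_left (by positivity) (le_max_right _ _))
    have h4 : 1 ≤ (k : ℝ) ^ s := Real.one_le_rpow hk hs0
    linarith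

end ErasureNetwork

theorem corollary3
    {S : Type*} [MeasurableSpace S] {Ω : Type*} [MeasurableSpace Ω]
    (prior : Bool → ℝ) (hprior : ∀ j, 0 < prior j) (hprior_sum : prior false + prior true = 1)
    (PX : Bool → Measure S) [∀ j, IsProbabilityMeasure (PX j)]
    (hPX₁₀ : PX true ≪ PX false) (hPX₀₁ : PX false ≪ PX true)
    (htails : ErasureNetwork.HasLinearTails prior PX)
    (P : Bool → Measure Ω) [∀ j, IsProbabilityMeasure (P j)]
    (q : ℕ → ℝ) (X : ℕ → Ω → S) (Z : ℕ → Ω → Bool)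
    (hmodel : ErasureNetwork.IsModel P PX q X Z)
    (ε : ℝ) (hε : 0 < ε) (hq : ∀ k, 1 ≤ k → q k ≤ 1 - ε)
    (m : ℕ → ℕ) (hm : ∀ k, 1 ≤ k → m k < k)
    (σ : ℝ) (hσ : σ ≤ 1)
    (hmσ : (fun k : ℕ => (m k : ℝ)) =Θ[atTop] fun k : ℕ => (k : ℝ) ^ σ)
    (d : ℕ → Ω → Bool) (hd_meas : ∀ k, Measurable (d k))
    (hd : ∀ k, 1 ≤ k → ∀ ω,
      ErasureNetwork.HasTandem (fun i => Z i ω) (ErasureNetwork.tandemLength m k) k →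
      d k ω = ErasureNetwork.tandemDecision prior PX (fun i => X i ω) (fun i => Z i ω)
        (ErasureNetwork.tandemLength m k) (ErasureNetwork.tandemLength m k) k) :
    (1 / 2 ≤ σ →
      (fun k : ℕ => ErasureNetwork.errorProb prior P (d k)) =Θ[atTop]
        fun k : ℕ => 1 / Real.sqrt (k : ℝ)) ∧
    (σ < 1 / 2 →
      (fun k : ℕ => ErasureNetwork.errorProb prior P (d k)) =Θ[atTop]
        fun k : ℕ => 1 / (k : ℝ) ^ σ) := by
  obtain ⟨a, A, ha, hA, herr⟩ :=
    hmodel.exists_errorProb_bounds hprior hprior_sum hPX₁₀ hPX₀₁ htails hε hq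
  -- Both regimes at once, with exponent `min σ (1 / 2)`.
  have key : (fun k : ℕ => ErasureNetwork.errorProb prior P (d k)) =Θ[atTop]
      fun k : ℕ => 1 / (k : ℝ) ^ min σ (1 / 2) := by
    obtain ⟨c, C, hc, hC, hn⟩ := ErasureNetwork.exists_tandemLength_bounds hmσ rfl
    have hbound : ∀ᶠ k : ℕ in atTop,
        a / C * (1 / (k : ℝ) ^ min σ (1 / 2)) ≤ ErasureNetwork.errorProb prior P (d k) ∧
        ErasureNetwork.errorProb prior P (d k) ≤ A / c * (1 / (k : ℝ) ^ min σ (1 / 2)) := by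
      filter_upwards [hn, eventually_ge_atTop 1] with k hk hk1
      obtain ⟨h1, h2⟩ := herr _ k (d k)
        (ErasureNetwork.tandemLength_isGreatest m k hk1).1.1 (hd k hk1)
      have hk0 : (0 : ℝ) < k := by exact_mod_cast hk1
      have hpow : 0 < (k : ℝ) ^ min σ (1 / 2) := by positivity
      have hn0 : (0 : ℝ) < ErasureNetwork.tandemLength m k + 1 := by positivity
      constructor
      · calc a / C * (1 / (k : ℝ) ^ min σ (1 / 2)) = a / (C * (k : ℝ) ^ min σ (1 / 2)) := by
              field_simp
          _ ≤ a / (ErasureNetwork.tandemLength m k + 1) := by gcongr; exact hk.2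
          _ ≤ _ := by rw [div_le_iff₀ hn0]; linarith
      · calc ErasureNetwork.errorProb prior P (d k)
            ≤ A / (ErasureNetwork.tandemLength m k + 1) := by rw [le_div_iff₀ hn0]; linarith
          _ ≤ A / (c * (k : ℝ) ^ min σ (1 / 2)) := by gcongr; exact hk.1
          _ = _ := by field_simp
    constructor
    · refine IsBigO.of_bound (A / c) ?_
      filter_upwards [hbound] with k hk
      have h0 : 0 ≤ 1 / (k : ℝ) ^ min σ (1 / 2) := by positivity
      rw [Real.norm_of_nonneg h0, Real.norm_of_nonneg (le_trans (by positivity) hk.1)]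
      exact hk.2
    · refine IsBigO.of_bound (C / a) ?_
      filter_upwards [hbound] with k hk
      have h0 : 0 ≤ 1 / (k : ℝ) ^ min σ (1 / 2) := by positivity
      rw [Real.norm_of_nonneg h0, Real.norm_of_nonneg (le_trans (by positivity) hk.1)]
      calc 1 / (k : ℝ) ^ min σ (1 / 2) = C / a * (a / C * (1 / (k : ℝ) ^ min σ (1 / 2))) := by
            field_simp
        _ ≤ _ := by gcongr; exact hk.1
  constructor
  · intro h
    rw [min_eq_right h] at key
    simpa only [Real.sqrt_eq_rpow] using key
  · intro h
    rwa [min_eq_left h.le] at key
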